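/- **Conventions.** An inverse semigroup with zero is a semigroup $S$ with a zero element in which every $a$ has exactly one $a^{-1}$ with $aa^{-1}a=a$ and $a^{-1}aa^{-1}=a^{-1}$. Its natural partial order is $a\le b \iff a=be$ for some idempotent $e$; elements $a,b$ are compatible, $a\sim b$, if $a^{-1}b$ and $ab^{-1}$ are idempotents. Homomorphisms preserve products and zero. $S$ is distributive if compatible pairs have joins and multiplication distributes over these joins on both sides; it is Boolean if moreover its idempotents form a generalized Boolean algebra under the natural partial order. A morphism of distributive inverse semigroups is a homomorphism that maps joins of compatible pairs to joins. For an inverse semigroup $S$ with zero, $\mathsf D(S)$ is the inverse semigroup of all sets $\{a_1,\dots,a_m\}^{\downarrow}=\{s: s\le a_i\text{ for some } i\}$, where $m\ge 1$ and $a_1,\dots,a_m\in S$ are pairwise compatible, under subset multiplication; its zero is $\{0\}$. A prime filter of $\mathsf D(S)$ is a nonempty, upwards closed, down-directed subset $P$ without the zero such that, for compatible $a,b$, if $a\vee b$ exists and lies in $P$, then $a\in P$ or $b\in P$. Let $X^{\uparrow}$ be the upward closure of $X$. The prime filters form a groupoid: with $\mathbf d(P)=(P^{-1}P)^{\uparrow}$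 and $\mathbf r(P)=(PP^{-1})^{\uparrow}$, the product $P\cdot Q=(PQ)^{\uparrow}$ is defined when $\mathbf d(P)=\mathbf r(Q)$, the inverse of $P$ is $P^{-1}$, and the identities are the prime filters that contain an idempotent. Sets of prime filters are multiplied and inverted elementwise; $X,Y$ are compatible if $X^{-1}Y$ and $XY^{-1}$ consist of identities. For $a\in\mathsf D(S)$ let $V_a$ be the set of prime filters of $\mathsf D(S)$ that contain $a$, and for $b\le a$ let $V_{a;b}=V_a\setminus V_b$. **Theorem (Booleanization).** 1. For every inverse semigroup $S$ with zero there are a Boolean inverse semigroup $\mathsf B(S)$ and an injective homomorphism $\beta\colon S\to\mathsf B(S)$ such that for every Boolean inverse semigroup $T$ and every homomorphism $\theta\colon S\to T$ there is a unique morphism $\gamma\colon\mathsf B(S)\to T$ with $\gamma(\beta(s))=\theta(s)$ for all $s\in S$. Moreover, up to isomorphism, $\mathsf B(S)$ consists of all unions of finite sets of pairwise compatible sets of the form $V_{a;b}$ ($a,b\in\mathsf D(S)$, $b\le a$), under subset multiplication, and $\beta(s)=V_{s^{\downarrow}}$. 2. The forgetful functor from the category of Boolean inverse semigroups and morphisms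 to the category of inverse semigroups with zero and homomorphisms has a left adjoint. -/

import Mathlib

open scoped Pointwise

universe u v w

namespace Booleanization

/-- An inverse semigroup with zero: every element has exactly one (von Neumann) inverse. -/
class InverseSemigroupWithZero (S : Type u) extends SemigroupWithZero S, Inv S where
  mul_inv_mul : ∀ a : S, a * a⁻¹ * a = a
  inv_mul_inv : ∀ a : S, a⁻¹ * a * a⁻¹ = a⁻¹
  inv_unique : ∀ a b : S, a * b * a = a → b * a * b = b → b = a⁻¹

section Basic

variable {S : Type u} [InverseSemigroupWithZero S]

/-- The natural partial order `a ≤ b`. -/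
def NatLE (a b : S) : Prop := ∃ e : S, IsIdempotentElem e ∧ a = b * e

/-- The compatibility relation `a ∼ b`. -/
def Compatible (a b : S) : Prop := IsIdempotentElem (a⁻¹ * b) ∧ IsIdempotentElem (a * b⁻¹)

/-- `c` is the join `a ∨ b` with respect to the natural partial order. -/
def IsJoin (a b c : S) : Prop :=
  NatLE a c ∧ NatLE b c ∧ ∀ d : S, NatLE a d → NatLE b d → NatLE c d

end Basic

/-- Distributive inverse semigroups: compatible pairs have joins, and multiplication
distributes over such joins. -/
class DistributiveInverseSemigroup (S : Type u) extends InverseSemigroupWithZero S where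
  exists_join : ∀ a b : S, Compatible a b → ∃ c : S, IsJoin a b c
  mul_join : ∀ a b c d : S, Compatible a b → IsJoin a b c → IsJoin (d * a) (d * b) (d * c)
  join_mul : ∀ a b c d : S, Compatible a b → IsJoin a b c → IsJoin (a * d) (b * d) (c * d)

/-- Boolean inverse semigroups: distributive ones whose idempotents, with the natural partial
order, form a (generalized) Boolean algebra. -/
class BooleanInverseSemigroup (S : Type u) extends DistributiveInverseSemigroup S where
  idempotents_boolean :
    ∃ G : GeneralizedBooleanAlgebra {e : S // IsIdempotentElem e},
      ∀ e f : {e : S // IsIdempotentElem e}, G.le e f ↔ NatLE e.1 f.1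

/-- Homomorphisms of inverse semigroups with zero (these preserve zero). -/
structure Hom (S : Type u) (T : Type v) [InverseSemigroupWithZero S] [InverseSemigroupWithZero T]
    extends S →ₙ* T where
  map_zero' : toFun 0 = 0

instance (S : Type u) (T : Type v) [InverseSemigroupWithZero S] [InverseSemigroupWithZero T] :
    CoeFun (Hom S T) (fun _ => S → T) := ⟨fun f => f.toFun⟩

/-- The composite `x ↦ g (f x)`. -/
def Hom.comp {S : Type u} {T : Type v} {R : Type w} [InverseSemigroupWithZero S]
    [InverseSemigroupWithZero T] [InverseSemigroupWithZero R] (g : Hom T R) (f : Hom S T) :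
    Hom S R where
  toFun x := g (f x)
  map_mul' x y := by
    have h1 := f.map_mul' x y
    have h2 := g.map_mul' (f x) (f y)
    simpa only [h1] using h2
  map_zero' := by
    have h1 := f.map_zero'
    have h2 := g.map_zero'
    simp [h1, h2]

def Hom.id (S : Type u) [InverseSemigroupWithZero S] : Hom S S where
  toFun x := x
  map_mul' _ _ := rfl
  map_zero' := rfl

/-- Morphisms between distributive inverse semigroups: homomorphisms that map binary compatible
joins to binary compatible joins. -/
structure Morphism (S : Type u) (T : Type v) [DistributiveInverseSemigroup S]
    [DistributiveInverseSemigroup T] extends Hom S T where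
  map_join' : ∀ a b c : S, Compatible a b → IsJoin a b c → IsJoin (toFun a) (toFun b) (toFun c)

section Basic

variable {S : Type u} [InverseSemigroupWithZero S]

open InverseSemigroupWithZero

theorem inv_inv_eq (a : S) : a⁻¹⁻¹ = a :=
  (InverseSemigroupWithZero.inv_unique a⁻¹ a (inv_mul_inv a) (mul_inv_mul a)).symm

theorem idem_inv {e : S} (h : IsIdempotentElem e) : e⁻¹ = e :=
  (InverseSemigroupWithZero.inv_unique e e (by rw [h.eq, h.eq]) (by rw [h.eq, h.eq])).symm

theorem idem_mul {e f : S} (he : IsIdempotentElem e) (hf : IsIdempotentElem f) :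
    IsIdempotentElem (e * f) := by
  have h1 := mul_inv_mul (e * f)
  have h2 := inv_mul_inv (e * f)
  set x := (e * f)⁻¹ with hx
  have h3 : f * x * e = x := by
    apply InverseSemigroupWithZero.inv_unique (e * f)
    · calc e * f * (f * x * e) * (e * f) = e * (f * f) * x * (e * e) * f := by
            simp only [mul_assoc]
        _ = e * f * x * (e * f) := by rw [he.eq, hf.eq]; simp only [mul_assoc]
        _ = e * f := h1
    · calc f * x * e * (e * f) * (f * x * e) = f * x * (e * e) * (f * f) * x * e := by
            simp only [mul_assoc]
        _ = f * (x * (e * f) * x) * e := by rw [he.eq, hf.eq]; simp only [mul_assoc]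
        _ = f * x * e := by rw [h2]
  have h4 : IsIdempotentElem x := by
    show x * x = x
    calc x * x = (f * x * e) * (f * x * e) := by rw [h3]
      _ = f * (x * (e * f) * x) * e := by simp only [mul_assoc]
      _ = x := by rw [h2, h3]
  have h5 : e * f = x := by rw [← idem_inv h4, hx, inv_inv_eq]
  rw [h5]; exact h4

theorem idem_comm {e f : S} (he : IsIdempotentElem e) (hf : IsIdempotentElem f) :
    e * f = f * e := by
  have key : ∀ {a b : S}, IsIdempotentElem a → IsIdempotentElem b →
      a * b * (b * a) * (a * b) = a * b := by
    intro a b ha hb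
    calc a * b * (b * a) * (a * b) = a * (b * b) * (a * a) * b := by simp only [mul_assoc]
      _ = a * b * (a * b) := by rw [ha.eq, hb.eq]; simp only [mul_assoc]
      _ = a * b := (idem_mul ha hb).eq
  have h := InverseSemigroupWithZero.inv_unique (e * f) (f * e) (key he hf) (key hf he)
  rw [h, idem_inv (idem_mul he hf)]

theorem idem_inv_mul (a : S) : IsIdempotentElem (a⁻¹ * a) := by
  show a⁻¹ * a * (a⁻¹ * a) = a⁻¹ * a
  rw [← mul_assoc, inv_mul_inv]

theorem idem_mul_inv (a : S) : IsIdempotentElem (a * a⁻¹) := by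
  show a * a⁻¹ * (a * a⁻¹) = a * a⁻¹
  rw [← mul_assoc, mul_inv_mul]

theorem mul_inv_eq (a b : S) : (a * b)⁻¹ = b⁻¹ * a⁻¹ := by
  symm
  have hc := idem_comm (idem_mul_inv b) (idem_inv_mul a)
  apply InverseSemigroupWithZero.inv_unique
  · calc a * b * (b⁻¹ * a⁻¹) * (a * b) = a * ((b * b⁻¹) * (a⁻¹ * a)) * b := by
          simp only [mul_assoc]
      _ = (a * a⁻¹ * a) * (b * b⁻¹ * b) := by rw [hc]; simp only [mul_assoc]
      _ = a * b := by rw [mul_inv_mul, mul_inv_mul]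
  · calc b⁻¹ * a⁻¹ * (a * b) * (b⁻¹ * a⁻¹) = b⁻¹ * ((a⁻¹ * a) * (b * b⁻¹)) * a⁻¹ := by
          simp only [mul_assoc]
      _ = (b⁻¹ * b * b⁻¹) * (a⁻¹ * a * a⁻¹) := by rw [← hc]; simp only [mul_assoc]
      _ = b⁻¹ * a⁻¹ := by rw [inv_mul_inv, inv_mul_inv]

theorem idem_conj (a : S) {e : S} (he : IsIdempotentElem e) : IsIdempotentElem (a * e * a⁻¹) := by
  show a * e * a⁻¹ * (a * e * a⁻¹) = a * e * a⁻¹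
  calc a * e * a⁻¹ * (a * e * a⁻¹) = a * (e * (a⁻¹ * a)) * e * a⁻¹ := by simp only [mul_assoc]
    _ = (a * a⁻¹ * a) * (e * e) * a⁻¹ := by
        rw [idem_comm he (idem_inv_mul a)]; simp only [mul_assoc]
    _ = a * e * a⁻¹ := by rw [mul_inv_mul, he.eq]

theorem natLE_refl (a : S) : NatLE a a :=
  ⟨a⁻¹ * a, idem_inv_mul a, by rw [← mul_assoc, mul_inv_mul]⟩

theorem natLE_iff_left {a b : S} : NatLE a b ↔ ∃ f : S, IsIdempotentElem f ∧ a = f * b := by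
  constructor
  · rintro ⟨e, he, rfl⟩
    refine ⟨b * e * b⁻¹, idem_conj b he, ?_⟩
    calc b * e = (b * b⁻¹ * b) * e := by rw [mul_inv_mul]
      _ = b * ((b⁻¹ * b) * e) := by simp only [mul_assoc]
      _ = b * e * b⁻¹ * b := by rw [idem_comm (idem_inv_mul b) he]; simp only [mul_assoc]
  · rintro ⟨f, hf, rfl⟩
    refine ⟨b⁻¹ * f * b, by simpa [inv_inv_eq] using idem_conj b⁻¹ hf, ?_⟩
    calc f * b = f * (b * b⁻¹ * b) := by rw [mul_inv_mul]
      _ = (f * (b * b⁻¹)) * b := by simp only [mul_assoc]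
      _ = b * (b⁻¹ * f * b) := by rw [idem_comm hf (idem_mul_inv b)]; simp only [mul_assoc]

theorem natLE_trans {a b c : S} (h : NatLE a b) (h' : NatLE b c) : NatLE a c := by
  obtain ⟨e, he, rfl⟩ := h
  obtain ⟨f, hf, rfl⟩ := h'
  exact ⟨f * e, idem_mul hf he, mul_assoc _ _ _⟩

theorem natLE_mul {a b c d : S} (h : NatLE a b) (h' : NatLE c d) : NatLE (a * c) (b * d) := by
  have h1 : NatLE (a * c) (a * d) := by
    obtain ⟨e, he, rfl⟩ := h'
    exact ⟨e, he, (mul_assoc _ _ _).symm⟩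
  refine natLE_trans h1 ?_
  obtain ⟨f, hf, rfl⟩ := natLE_iff_left.1 h
  exact natLE_iff_left.2 ⟨f, hf, mul_assoc _ _ _⟩

theorem natLE_inv {a b : S} (h : NatLE a b) : NatLE a⁻¹ b⁻¹ := by
  obtain ⟨e, he, rfl⟩ := h
  exact natLE_iff_left.2 ⟨e, he, by rw [mul_inv_eq, idem_inv he]⟩

theorem idem_of_natLE {a e : S} (h : NatLE a e) (he : IsIdempotentElem e) :
    IsIdempotentElem a := by
  obtain ⟨f, hf, rfl⟩ := h
  exact idem_mul he hf

theorem compatible_of_natLE {a b c d : S} (h : Compatible b d) (hab : NatLE a b)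
    (hcd : NatLE c d) : Compatible a c :=
  ⟨idem_of_natLE (natLE_mul (natLE_inv hab) hcd) h.1,
    idem_of_natLE (natLE_mul hab (natLE_inv hcd)) h.2⟩

theorem compatible_inv {a b : S} (h : Compatible a b) : Compatible a⁻¹ b⁻¹ :=
  ⟨by rw [inv_inv_eq]; exact h.2, by rw [inv_inv_eq]; exact h.1⟩

theorem natLE_idem_mul {e : S} (he : IsIdempotentElem e) (a : S) : NatLE (e * a) a :=
  natLE_iff_left.2 ⟨e, he, rfl⟩

theorem compatible_mul {a b c d : S} (h : Compatible a c) (h' : Compatible b d) :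
    Compatible (a * b) (c * d) := by
  constructor
  · have : (a * b)⁻¹ * (c * d) = b⁻¹ * ((a⁻¹ * c) * d) := by
      rw [mul_inv_eq]; simp only [mul_assoc]
    rw [this]
    exact idem_of_natLE (natLE_mul (natLE_refl _) (natLE_idem_mul h.1 d)) h'.1
  · have : a * b * (c * d)⁻¹ = a * ((b * d⁻¹) * c⁻¹) := by
      rw [mul_inv_eq]; simp only [mul_assoc]
    rw [this]
    exact idem_of_natLE (natLE_mul (natLE_refl _) (natLE_idem_mul h'.2 c⁻¹)) h.2

/-- `X↓`. -/
def down (X : Set S) : Set S := {s | ∃ x ∈ X, NatLE s x}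

/-- `X↑`. -/
def up (X : Set S) : Set S := {s | ∃ x ∈ X, NatLE x s}

theorem down_mul (F G : Set S) : down F * down G = down (F * G) := by
  ext s
  constructor
  · rintro ⟨a, ⟨x, hx, hax⟩, b, ⟨y, hy, hby⟩, rfl⟩
    exact ⟨x * y, Set.mul_mem_mul hx hy, natLE_mul hax hby⟩
  · rintro ⟨_, ⟨x, hx, y, hy, rfl⟩, e, he, rfl⟩
    exact ⟨x, ⟨x, hx, natLE_refl x⟩, y * e, ⟨y, hy, e, he, rfl⟩, (mul_assoc x y e).symm⟩

theorem down_inv (F : Set S) : (down F)⁻¹ = down F⁻¹ := by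
  ext s
  constructor
  · rintro ⟨x, hx, h⟩
    exact ⟨x⁻¹, by rw [Set.mem_inv, inv_inv_eq]; exact hx, by simpa [inv_inv_eq] using natLE_inv h⟩
  · rintro ⟨x, hx, h⟩
    exact ⟨x⁻¹, hx, natLE_inv h⟩

end Basic

section DistributiveCompletion

variable (S : Type u) [InverseSemigroupWithZero S]

/-- The distributive completion `D(S)`: the finitely generated compatible order ideals
`{a₁, …, aₘ}↓` of `S`. As `S` has a zero, all its order ideals are taken to be nonempty, and
`{0}` is the zero of `D(S)`. -/
def DistCompletion : Type u :=
  {A : Set S // ∃ F : Set S, F.Finite ∧ F.Nonempty ∧ (∀ a ∈ F, ∀ b ∈ F, Compatible a b) ∧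
    A = down F}

variable {S}

open InverseSemigroupWithZero

theorem DistCompletion.compat (A : DistCompletion S) {a b : S} (ha : a ∈ A.1) (hb : b ∈ A.1) :
    Compatible a b := by
  obtain ⟨F, -, -, hF, hA⟩ := A.2
  rw [hA] at ha hb
  obtain ⟨x, hx, hax⟩ := ha
  obtain ⟨y, hy, hby⟩ := hb
  exact compatible_of_natLE (hF x hx y hy) hax hby

theorem DistCompletion.lower (A : DistCompletion S) {a b : S} (hb : b ∈ A.1) (h : NatLE a b) :
    a ∈ A.1 := by
  obtain ⟨F, -, -, hF, hA⟩ := A.2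
  rw [hA] at hb ⊢
  obtain ⟨y, hy, hby⟩ := hb
  exact ⟨y, hy, natLE_trans h hby⟩

theorem DistCompletion.nonempty (A : DistCompletion S) : A.1.Nonempty := by
  obtain ⟨A, F, -, ⟨x, hx⟩, hF, rfl⟩ := A
  exact ⟨x, x, hx, natLE_refl x⟩

/-- Multiplication in `D(S)` is subset multiplication. -/
instance : Mul (DistCompletion S) where
  mul A B := ⟨A.1 * B.1, by
    obtain ⟨A, F, hF, hF0, hFc, rfl⟩ := A
    obtain ⟨B, G, hG, hG0, hGc, rfl⟩ := B
    refine ⟨F * G, hF.mul hG, hF0.mul hG0, ?_, down_mul F G⟩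
    rintro _ ⟨a, ha, b, hb, rfl⟩ _ ⟨c, hc, d, hd, rfl⟩
    exact compatible_mul (hFc a ha c hc) (hGc b hb d hd)⟩

/-- Inversion in `D(S)` is elementwise. -/
instance : Inv (DistCompletion S) where
  inv A := ⟨A.1⁻¹, by
    obtain ⟨A, F, hF, ⟨x, hx⟩, hFc, rfl⟩ := A
    have hFi : F⁻¹ = (fun x => x⁻¹) '' F := by
      ext y
      constructor
      · intro hy
        exact ⟨y⁻¹, hy, inv_inv_eq y⟩
      · rintro ⟨z, hz, rfl⟩
        rw [Set.mem_inv, inv_inv_eq]; exact hz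
    refine ⟨F⁻¹, hFi ▸ hF.image _, hFi ▸ ⟨x⁻¹, x, hx, rfl⟩, ?_, down_inv F⟩
    intro a ha b hb
    simpa [inv_inv_eq] using compatible_inv (hFc _ ha _ hb)⟩

theorem idem_zero : IsIdempotentElem (0 : S) := mul_zero 0

instance : Zero (DistCompletion S) where
  zero := ⟨{0}, {0}, Set.finite_singleton 0, Set.singleton_nonempty 0, by
    rintro a rfl b rfl
    exact ⟨by rw [mul_zero]; exact idem_zero, by rw [zero_mul]; exact idem_zero⟩, by
    ext s
    constructor
    · rintro rfl
      exact ⟨0, rfl, natLE_refl 0⟩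
    · rintro ⟨_, rfl, e, -, rfl⟩
      exact zero_mul e⟩

theorem DistCompletion.mul_val (A B : DistCompletion S) : (A * B).1 = A.1 * B.1 := rfl
theorem DistCompletion.inv_val (A : DistCompletion S) : (A⁻¹).1 = A.1⁻¹ := rfl
theorem DistCompletion.zero_val : (0 : DistCompletion S).1 = {0} := rfl

theorem DistCompletion.mul_assoc' (A B C : DistCompletion S) : A * B * C = A * (B * C) :=
  Subtype.ext (mul_assoc A.1 B.1 C.1)

theorem DistCompletion.inv_inv' (A : DistCompletion S) : A⁻¹⁻¹ = A := by
  apply Subtype.ext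
  ext s
  rw [inv_val, inv_val, Set.mem_inv, Set.mem_inv, inv_inv_eq]

theorem DistCompletion.mul_inv_mul' (A : DistCompletion S) : A * A⁻¹ * A = A := by
  apply Subtype.ext
  ext s
  rw [mul_val, mul_val, inv_val]
  constructor
  · rintro ⟨_, ⟨a, ha, b, hb, rfl⟩, c, hc, rfl⟩
    have h := (A.compat ha hb).2
    rw [inv_inv_eq] at h
    exact A.lower hc (natLE_idem_mul h c)
  · intro hs
    refine ⟨s * s⁻¹, ⟨s, hs, s⁻¹, ?_, rfl⟩, s, hs, mul_inv_mul s⟩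
    rw [Set.mem_inv, inv_inv_eq]; exact hs

/-- Idempotents of `D(S)` consist of idempotents. -/
theorem DistCompletion.idem_subset (A : DistCompletion S) (h : A * A = A) {a : S}
    (ha : a ∈ A.1) : IsIdempotentElem a := by
  have h1 : A⁻¹ = (A⁻¹ * A) * (A * A⁻¹) := by
    have h0 := mul_inv_mul' A⁻¹
    rw [inv_inv'] at h0
    calc A⁻¹ = A⁻¹ * (A * A) * A⁻¹ := by rw [h, h0]
      _ = (A⁻¹ * A) * (A * A⁻¹) := by simp only [mul_assoc']
  have h2 : a⁻¹ ∈ (A⁻¹).1 := by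
    rw [inv_val, Set.mem_inv, inv_inv_eq]; exact ha
  rw [h1] at h2
  obtain ⟨_, ⟨b, hb, c, hc, rfl⟩, _, ⟨d, hd, e, he, rfl⟩, hh⟩ := h2
  have hbc := (A.compat hb hc).1
  have hde := (A.compat hd he).2
  rw [inv_inv_eq] at hbc hde
  have h3 : IsIdempotentElem a⁻¹ := by
    rw [← hh]; exact idem_mul hbc hde
  rw [← inv_inv_eq a, idem_inv h3]; exact h3

theorem DistCompletion.idem_comm' (A B : DistCompletion S) (hA : A * A = A) (hB : B * B = B) :
    A * B = B * A := by
  apply Subtype.ext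
  ext s
  rw [mul_val, mul_val]
  constructor
  · rintro ⟨a, ha, b, hb, rfl⟩
    exact ⟨b, hb, a, ha, idem_comm (B.idem_subset hB hb) (A.idem_subset hA ha)⟩
  · rintro ⟨b, hb, a, ha, rfl⟩
    exact ⟨a, ha, b, hb, idem_comm (A.idem_subset hA ha) (B.idem_subset hB hb)⟩

instance : InverseSemigroupWithZero (DistCompletion S) where
  mul_assoc := DistCompletion.mul_assoc'
  zero_mul A := by
    apply Subtype.ext
    rw [DistCompletion.mul_val, DistCompletion.zero_val]
    ext s
    constructor
    · rintro ⟨_, rfl, b, -, rfl⟩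
      exact zero_mul b
    · rintro rfl
      obtain ⟨a, ha⟩ := A.nonempty
      exact ⟨0, rfl, a, ha, zero_mul a⟩
  mul_zero A := by
    apply Subtype.ext
    rw [DistCompletion.mul_val, DistCompletion.zero_val]
    ext s
    constructor
    · rintro ⟨b, -, _, rfl, rfl⟩
      exact mul_zero b
    · rintro rfl
      obtain ⟨a, ha⟩ := A.nonempty
      exact ⟨a, ha, 0, rfl, mul_zero a⟩
  mul_inv_mul := DistCompletion.mul_inv_mul'
  inv_mul_inv A := by
    have h := DistCompletion.mul_inv_mul' A⁻¹
    rwa [DistCompletion.inv_inv'] at h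
  inv_unique A B h1 h2 := by
    have k1 := DistCompletion.mul_inv_mul' A
    have k2 : A⁻¹ * A * A⁻¹ = A⁻¹ := by
      have h := DistCompletion.mul_inv_mul' A⁻¹
      rwa [DistCompletion.inv_inv'] at h
    have as := @DistCompletion.mul_assoc' S _
    set C := A⁻¹
    have c1 : (B * A) * (C * A) = (C * A) * (B * A) :=
      DistCompletion.idem_comm' _ _ (by rw [← as, h2]) (by rw [← as, k2])
    have c2 : (A * B) * (A * C) = (A * C) * (A * B) :=
      DistCompletion.idem_comm' _ _ (by rw [← as, h1]) (by rw [← as, k1])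
    have e1 : C * A = B * A := by
      calc C * A = C * (A * B * A) := by rw [h1]
        _ = (C * A) * (B * A) := by simp only [as]
        _ = (B * A) * (C * A) := c1.symm
        _ = B * (A * C * A) := by simp only [as]
        _ = B * A := by rw [k1]
    have e2 : A * C = A * B := by
      calc A * C = (A * B * A) * C := by rw [h1]
        _ = (A * B) * (A * C) := by simp only [as]
        _ = (A * C) * (A * B) := c2
        _ = (A * C * A) * B := by simp only [as]
        _ = A * B := by rw [k1]
    calc B = B * A * B := h2.symm
      _ = C * A * B := by rw [e1]
      _ = C * (A * B) := as _ _ _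
      _ = C * (A * C) := by rw [e2]
      _ = C * A * C := (as _ _ _).symm
      _ = C := k2

/-- The principal order ideal `s↓`, as an element of `D(S)`. -/
def principal (s : S) : DistCompletion S :=
  ⟨down {s}, {s}, Set.finite_singleton s, Set.singleton_nonempty s, by
    rintro a rfl b rfl
    exact ⟨idem_inv_mul _, idem_mul_inv _⟩, rfl⟩

end DistributiveCompletion

section PrimeFilters

variable {S : Type u} [InverseSemigroupWithZero S]

/-- Prime filters: nonempty, upwards closed, down-directed subsets without zero such that
`a ∨ b ∈ P` implies `a ∈ P` or `b ∈ P`, for compatible `a`, `b`. -/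
structure IsPrimeFilter (P : Set S) : Prop where
  nonempty : P.Nonempty
  up_closed : up P = P
  directed : ∀ a ∈ P, ∀ b ∈ P, ∃ c ∈ P, NatLE c a ∧ NatLE c b
  proper : (0 : S) ∉ P
  prime : ∀ a b c : S, Compatible a b → IsJoin a b c → c ∈ P → a ∈ P ∨ b ∈ P

/-- `d(P) = (P⁻¹P)↑`. -/
def dom (P : Set S) : Set S := up (P⁻¹ * P)

/-- `r(P) = (PP⁻¹)↑`. -/
def ran (P : Set S) : Set S := up (P * P⁻¹)

variable (S) in
/-- The identities of the groupoid of prime filters. -/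
def identities : Set (Set S) := {P | IsPrimeFilter P ∧ ∃ e ∈ P, IsIdempotentElem e}

/-- Subset multiplication for the groupoid of prime filters, in which `P · Q` is defined when
`d(P) = r(Q)`, and is then `(PQ)↑`. -/
def bisMul (X Y : Set (Set S)) : Set (Set S) :=
  {R | ∃ P ∈ X, ∃ Q ∈ Y, dom P = ran Q ∧ R = up (P * Q)}

/-- `X⁻¹ = {P⁻¹ : P ∈ X}`. -/
def bisInv (X : Set (Set S)) : Set (Set S) := (fun P : Set S => P⁻¹) '' X

/-- Compatibility of partial bisections `X`, `Y`: both `X⁻¹Y` and `XY⁻¹` are idempotents, that is,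
they consist of identities. -/
def BisCompatible (X Y : Set (Set S)) : Prop :=
  bisMul (bisInv X) Y ⊆ identities S ∧ bisMul X (bisInv Y) ⊆ identities S

/-- `V_a`, the set of all prime filters that contain `a`. -/
def V (a : S) : Set (Set S) := {P | IsPrimeFilter P ∧ a ∈ P}

variable (S) in
/-- All unions of finite compatible sets of sets of the form `V_{a;b} = V_a \ V_b`, `b ≤ a`. -/
def finiteUnions : Set (Set (Set S)) :=
  {X | ∃ F : Set (Set (Set S)), F.Finite ∧
    (∀ Y ∈ F, ∃ a b : S, NatLE b a ∧ Y = V a \ V b) ∧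
    (∀ Y ∈ F, ∀ Z ∈ F, BisCompatible Y Z) ∧ X = ⋃₀ F}

end PrimeFilters

section Categories

open CategoryTheory

/-- The category of inverse semigroups with zero. -/
structure InvCat : Type (u + 1) where
  carrier : Type u
  [str : InverseSemigroupWithZero carrier]

attribute [instance] InvCat.str

instance : Category InvCat.{u} where
  Hom X Y := Hom X.carrier Y.carrier
  id X := Hom.id X.carrier
  comp f g := Hom.comp g f

/-- The category of Boolean inverse semigroups and morphisms. -/
structure BoolCat : Type (u + 1) where
  carrier : Type u
  [str : BooleanInverseSemigroup carrier]

attribute [instance] BoolCat.str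

instance : Category BoolCat.{u} where
  Hom X Y := Morphism X.carrier Y.carrier
  id X := { Hom.id X.carrier with map_join' := fun _ _ _ _ h => h }
  comp {X Y Z} f g :=
    { Hom.comp g.toHom f.toHom with
      map_join' := fun a b c hab h => by
        refine g.map_join' _ _ _ ?_ (f.map_join' a b c hab h)
        have hinv : ∀ x : X.carrier, f.toFun x⁻¹ = (f.toFun x)⁻¹ := by
          intro x
          apply InverseSemigroupWithZero.inv_unique
          · rw [← f.map_mul', ← f.map_mul', InverseSemigroupWithZero.mul_inv_mul]
          · rw [← f.map_mul', ← f.map_mul', InverseSemigroupWithZero.inv_mul_inv]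
        constructor
        · rw [← hinv, ← f.map_mul']
          have h1 := congrArg f.toFun hab.1.eq
          rw [f.map_mul'] at h1
          exact h1
        · rw [← hinv, ← f.map_mul']
          have h1 := congrArg f.toFun hab.2.eq
          rw [f.map_mul'] at h1
          exact h1 }

/-- The forgetful functor from Boolean inverse semigroups to inverse semigroups with zero. -/
def forgetful : BoolCat.{u} ⥤ InvCat.{u} where
  obj X := ⟨X.carrier⟩
  map f := Morphism.toHom f

end Categories

end Booleanization

open Booleanization

/-! A prime filter of `DistCompletion S` is determined by the principal ideals that it contains, and
these form a proper filter of `S`. Every proper filter of `S` arises in this way, because compatible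
joins in the completion are unions (`isPrimeFilter_iff`). The principal filters `up {r}` with `r ≠
0` already tell the relevant sets of prime filters apart. Hence the Booleanization can be built
without filters, inside the groupoid of nonzero elements of `S`, in which `r · q` is defined when
`r⁻¹r = qq⁻¹`. The counterpart of a set V_{a;b} with principal `a` is `cone s L`, and `Bis S`
consists of the finite unions of cones that are bisections.

Cones are closed under products and inverses, since the conditions in `L` are carried along by
conjugation (`resMul_cone`, `inv_cone`). In `Bis S` the natural order is inclusion and compatible
joins are unions; relative complements of idempotents exist by `Constructible.diff`. So `Bis S` is
Boolean.

A morphism that extends `θ` must send `cone s L` to the relative complement of `θ '' L` in `θ s`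
(`Morphism.isRelCompl_ofCone`) and unions to joins, so it is unique. For existence, the join has to
be independent of the decomposition into cones, which is the content of `natLE_of_mem_pieces`. If
finitely many cones cover a cone, split its piece along the images of all idempotents involved. A
nonzero part lies below `θ r` for some `r` in the cone, and the covering cone that contains `r` has
a piece above this part. Multiplicativity comes from `IsRelCompl.mul`.

The description by prime filters is `spec`, which collects the filters that are eventually in a set.
A proper filter decides every constructible set (`Constructible.eventuallyIn_or`), so `spec`
respects finite unions; filters factor along products (`exists_factor`), so it is multiplicative;
and principal filters make it injective (`spec_subset_iff`). The left adjoint results from the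
universal arrows. -/

namespace Booleanization

/-! ### The natural order and compatibility -/

section Order

variable {S : Type u} [InverseSemigroupWithZero S]

open InverseSemigroupWithZero

theorem natLE_mul_idem {e : S} (he : IsIdempotentElem e) (a : S) : NatLE (a * e) a :=
  ⟨e, he, rfl⟩

theorem mul_inv_mul_of_natLE {a b : S} (h : NatLE a b) : b * (a⁻¹ * a) = a := by
  obtain ⟨f, hf, rfl⟩ := natLE_iff_left.1 h
  rw [mul_inv_eq, idem_inv hf]
  calc b * (b⁻¹ * f * (f * b)) = (b * b⁻¹) * (f * f) * b := by simp only [mul_assoc]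
    _ = (b * b⁻¹) * f * b := by rw [hf.eq]
    _ = f * (b * b⁻¹ * b) := by rw [idem_comm (idem_mul_inv b) hf]; simp only [mul_assoc]
    _ = f * b := by rw [mul_inv_mul]

theorem mul_mul_inv_of_natLE {a b : S} (h : NatLE a b) : (a * a⁻¹) * b = a := by
  have := congrArg (·⁻¹) (mul_inv_mul_of_natLE (natLE_inv h))
  simpa only [mul_inv_eq, inv_inv_eq] using this

theorem mul_inv_mul_self_of_natLE {a b : S} (h : NatLE a b) : a * (b⁻¹ * b) = a := by
  obtain ⟨f, hf, rfl⟩ := natLE_iff_left.1 h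
  rw [mul_assoc, ← mul_assoc b, mul_inv_mul]

theorem mul_inv_of_natLE {a b : S} (h : NatLE a b) : a * b⁻¹ = a * a⁻¹ := by
  have := mul_mul_inv_of_natLE (natLE_inv h)
  rw [inv_inv_eq] at this
  conv_lhs => rw [← mul_inv_mul a, mul_assoc a, mul_assoc, this]

theorem natLE_antisymm {a b : S} (h : NatLE a b) (h' : NatLE b a) : a = b := by
  obtain ⟨e, he, rfl⟩ := h
  rw [← mul_inv_mul_of_natLE h', mul_assoc, idem_comm (idem_inv_mul b) he, ← mul_assoc,
    mul_assoc b e e, he.eq]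

theorem natLE_of_eq {a b : S} (h : a = b) : NatLE a b := h ▸ natLE_refl a

theorem zero_natLE (a : S) : NatLE 0 a := ⟨0, idem_zero, (mul_zero a).symm⟩

theorem eq_zero_of_natLE {a : S} (h : NatLE a 0) : a = 0 := natLE_antisymm h (zero_natLE a)

theorem inv_zero_eq : (0 : S)⁻¹ = 0 := idem_inv idem_zero

theorem inv_injective {a b : S} (h : a⁻¹ = b⁻¹) : a = b := by
  rw [← inv_inv_eq a, h, inv_inv_eq]

theorem inv_eq_zero_iff {a : S} : a⁻¹ = 0 ↔ a = 0 :=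
  ⟨fun h => by rw [← inv_inv_eq a, h, inv_zero_eq], fun h => by rw [h, inv_zero_eq]⟩

theorem natLE_inv_iff {a b : S} : NatLE a⁻¹ b⁻¹ ↔ NatLE a b :=
  ⟨fun h => by simpa only [inv_inv_eq] using natLE_inv h, natLE_inv⟩

theorem idem_conj' (a : S) {e : S} (he : IsIdempotentElem e) :
    IsIdempotentElem (a⁻¹ * e * a) := by
  simpa only [inv_inv_eq] using idem_conj a⁻¹ he

theorem mul_idem_comm {e f : S} (he : IsIdempotentElem e) (hf : IsIdempotentElem f) (a : S) :
    a * e * f = a * f * e := by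
  rw [mul_assoc, idem_comm he hf, mul_assoc]

theorem mul_idem_mul_idem {e : S} (he : IsIdempotentElem e) (a : S) : a * e * e = a * e := by
  rw [mul_assoc, he.eq]

theorem mul_eq_self_of_natLE {a b e : S} (h : NatLE a b) (he : IsIdempotentElem e)
    (hb : b * e = b) : a * e = a := by
  obtain ⟨f, hf, rfl⟩ := h
  rw [mul_idem_comm hf he, hb]

theorem mul_eq_zero_of_natLE {a b c : S} (h : NatLE a b) (hb : b * c = 0) : a * c = 0 :=
  eq_zero_of_natLE (hb ▸ natLE_mul h (natLE_refl c))

theorem natLE_mul_of_mul_eq {a b e : S} (h : NatLE a b) (he : a * e = a) : NatLE a (b * e) := by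
  have := natLE_mul h (natLE_refl e)
  rwa [he] at this

/-- The initial idempotent of a restriction acts by conjugation. -/
theorem conj_inv_mul (t p : S) :
    (p * t⁻¹)⁻¹ * (p * t⁻¹) = t * (p⁻¹ * p) * (t * (p⁻¹ * p))⁻¹ := by
  rw [mul_inv_eq, mul_inv_eq, inv_inv_eq, idem_inv (idem_inv_mul p)]
  calc t * p⁻¹ * (p * t⁻¹) = t * (p⁻¹ * p) * t⁻¹ := by simp only [mul_assoc]
    _ = t * ((p⁻¹ * p) * (p⁻¹ * p)) * t⁻¹ := by rw [(idem_inv_mul p).eq]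
    _ = t * (p⁻¹ * p) * ((p⁻¹ * p) * t⁻¹) := by simp only [mul_assoc]

theorem mul_mul_inv_mul_cancel (t p : S) {s : S} (h : NatLE p (s * t)) : p * t⁻¹ * t = p := by
  obtain ⟨f, hf, rfl⟩ := natLE_iff_left.1 h
  calc f * (s * t) * t⁻¹ * t = f * s * (t * t⁻¹ * t) := by simp only [mul_assoc]
    _ = f * (s * t) := by rw [mul_inv_mul, mul_assoc]

/-- This factors an element `p ≤ s * t` into `p * t⁻¹ ≤ s` and `t * (p⁻¹ * p) ≤ t`, which are
composable by `conj_inv_mul`. The same factorization serves for elements of cones, for relative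
complements and for filters. -/
theorem mul_inv_mul_mul_cancel (t p : S) {s : S} (h : NatLE p (s * t)) :
    p * t⁻¹ * (t * (p⁻¹ * p)) = p := by
  rw [← mul_assoc, mul_mul_inv_mul_cancel t p h, ← mul_assoc, mul_inv_mul]

theorem mul_inv_natLE {s t p : S} (h : NatLE p (s * t)) : NatLE (p * t⁻¹) s := by
  refine natLE_trans (natLE_mul h (natLE_refl _)) ?_
  rw [mul_assoc]
  exact natLE_mul_idem (idem_mul_inv t) s

theorem Compatible.natLE_left {a b : S} (h : Compatible a b) : NatLE (a * (b⁻¹ * b)) b := by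
  rw [← mul_assoc]; exact natLE_idem_mul h.2 b

theorem Compatible.symm {a b : S} (h : Compatible a b) : Compatible b a := by
  constructor
  · have := h.1
    rw [← idem_inv this, mul_inv_eq, inv_inv_eq] at this; exact this
  · have := h.2
    rw [← idem_inv this, mul_inv_eq, inv_inv_eq] at this; exact this

theorem compatible_refl (a : S) : Compatible a a := ⟨idem_inv_mul a, idem_mul_inv a⟩

theorem compatible_zero (a : S) : Compatible a 0 :=
  ⟨by rw [mul_zero]; exact idem_zero, by rw [inv_zero_eq, mul_zero]; exact idem_zero⟩

theorem compatible_of_common_bound {a b c : S} (h : NatLE a c) (h' : NatLE b c) :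
    Compatible a b :=
  compatible_of_natLE (compatible_refl c) h h'

theorem compatible_of_idem {a b : S} (ha : IsIdempotentElem a) (hb : IsIdempotentElem b) :
    Compatible a b :=
  ⟨by rw [idem_inv ha]; exact idem_mul ha hb, by rw [idem_inv hb]; exact idem_mul ha hb⟩

theorem natLE_of_mul_inv_idem {a b : S} (h : IsIdempotentElem (a * b⁻¹))
    (hd : a⁻¹ * a = b⁻¹ * b) : NatLE a b := by
  refine natLE_iff_left.2 ⟨a * b⁻¹, h, ?_⟩
  rw [mul_assoc, ← hd, ← mul_assoc, mul_inv_mul]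

/-- Equal domains give `a = (a * b⁻¹) * b`, hence `a ≤ b`; the idempotent `a * b⁻¹` equals its
inverse `b * a⁻¹`, hence also `b ≤ a`. In this way compatibility turns into the injectivity
conditions of a bisection. -/
theorem eq_of_mul_inv_idem {a b : S} (h : IsIdempotentElem (a * b⁻¹))
    (hd : a⁻¹ * a = b⁻¹ * b) : a = b := by
  refine natLE_antisymm (natLE_of_mul_inv_idem h hd) (natLE_of_mul_inv_idem ?_ hd.symm)
  rw [← idem_inv h, mul_inv_eq, inv_inv_eq] at h
  exact h

theorem eq_of_inv_mul_idem {a b : S} (h : IsIdempotentElem (a⁻¹ * b))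
    (hd : a * a⁻¹ = b * b⁻¹) : a = b := by
  apply inv_injective
  apply eq_of_mul_inv_idem
  · rwa [inv_inv_eq]
  · rwa [inv_inv_eq, inv_inv_eq]

end Order

/-! ### The restricted product and bisections -/

section Groupoid

variable {S : Type u} [InverseSemigroupWithZero S]

open InverseSemigroupWithZero

theorem restricted_dom {r q : S} (h : r⁻¹ * r = q * q⁻¹) : (r * q)⁻¹ * (r * q) = q⁻¹ * q := by
  rw [mul_inv_eq]
  calc q⁻¹ * r⁻¹ * (r * q) = q⁻¹ * (r⁻¹ * r) * q := by simp only [mul_assoc]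
    _ = q⁻¹ * (q * q⁻¹ * q) := by rw [h]; simp only [mul_assoc]
    _ = q⁻¹ * q := by rw [mul_inv_mul]

theorem restricted_ran {r q : S} (h : r⁻¹ * r = q * q⁻¹) : (r * q) * (r * q)⁻¹ = r * r⁻¹ := by
  rw [mul_inv_eq]
  calc r * q * (q⁻¹ * r⁻¹) = r * (q * q⁻¹) * r⁻¹ := by simp only [mul_assoc]
    _ = (r * r⁻¹ * r) * r⁻¹ := by rw [← h]; simp only [mul_assoc]
    _ = r * r⁻¹ := by rw [mul_inv_mul]

theorem restricted_ne_zero {r q : S} (h : r⁻¹ * r = q * q⁻¹) (hr : r ≠ 0) : r * q ≠ 0 := by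
  intro h0
  apply hr
  calc r = r * (r⁻¹ * r) := by rw [← mul_assoc, mul_inv_mul]
    _ = r * q * q⁻¹ := by rw [h, mul_assoc]
    _ = 0 := by rw [h0, zero_mul]

/-- Subset multiplication in the groupoid of elements of `S`, in which `r · q` is defined when
`r⁻¹r = qq⁻¹`. -/
def resMul (X Y : Set S) : Set S := {p | ∃ r ∈ X, ∃ q ∈ Y, r⁻¹ * r = q * q⁻¹ ∧ p = r * q}

theorem resMul_assoc (X Y Z : Set S) : resMul (resMul X Y) Z = resMul X (resMul Y Z) := by
  ext p
  constructor
  · rintro ⟨_, ⟨x, hx, y, hy, hxy, rfl⟩, z, hz, hyz, rfl⟩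
    rw [restricted_dom hxy] at hyz
    exact ⟨x, hx, y * z, ⟨y, hy, z, hz, hyz, rfl⟩, by rw [restricted_ran hyz, hxy],
      mul_assoc x y z⟩
  · rintro ⟨x, hx, _, ⟨y, hy, z, hz, hyz, rfl⟩, hxy, rfl⟩
    rw [restricted_ran hyz] at hxy
    exact ⟨x * y, ⟨x, hx, y, hy, hxy, rfl⟩, z, hz, by rw [restricted_dom hxy, hyz],
      (mul_assoc x y z).symm⟩

theorem resMul_mono {X X' Y Y' : Set S} (h : X ⊆ X') (h' : Y ⊆ Y') :
    resMul X Y ⊆ resMul X' Y' := by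
  rintro _ ⟨x, hx, y, hy, hxy, rfl⟩
  exact ⟨x, h hx, y, h' hy, hxy, rfl⟩

theorem mem_inv_set {X : Set S} {a : S} : a ∈ X⁻¹ ↔ a⁻¹ ∈ X := Iff.rfl

theorem inv_mem_inv {X : Set S} {a : S} : a⁻¹ ∈ X⁻¹ ↔ a ∈ X := by
  rw [mem_inv_set, inv_inv_eq]

theorem inv_inv_set (X : Set S) : X⁻¹⁻¹ = X := by
  ext a; rw [mem_inv_set, inv_mem_inv]

theorem inv_subset_inv {X Y : Set S} (h : X ⊆ Y) : X⁻¹ ⊆ Y⁻¹ := fun _ ha => h ha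

/-- Sets of nonzero elements on which the domain and the range maps are injective. -/
structure IsBisection (X : Set S) : Prop where
  zero_notMem : (0 : S) ∉ X
  dom_inj : ∀ a ∈ X, ∀ b ∈ X, a⁻¹ * a = b⁻¹ * b → a = b
  ran_inj : ∀ a ∈ X, ∀ b ∈ X, a * a⁻¹ = b * b⁻¹ → a = b

theorem IsBisection.mono {X Y : Set S} (hY : IsBisection Y) (h : X ⊆ Y) : IsBisection X :=
  ⟨fun h0 => hY.1 (h h0), fun a ha b hb => hY.2 a (h ha) b (h hb),
    fun a ha b hb => hY.3 a (h ha) b (h hb)⟩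

theorem IsBisection.resMul {X Y : Set S} (hX : IsBisection X) (hY : IsBisection Y) :
    IsBisection (resMul X Y) := by
  refine ⟨?_, ?_, ?_⟩
  · rintro ⟨x, hx, y, hy, hxy, h0⟩
    exact restricted_ne_zero hxy (fun h => hX.1 (h ▸ hx)) h0.symm
  · rintro _ ⟨x, hx, y, hy, hxy, rfl⟩ _ ⟨x', hx', y', hy', hxy', rfl⟩ h
    rw [restricted_dom hxy, restricted_dom hxy'] at h
    obtain rfl := hY.2 _ hy _ hy' h
    obtain rfl := hX.2 _ hx _ hx' (hxy.trans hxy'.symm)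
    rfl
  · rintro _ ⟨x, hx, y, hy, hxy, rfl⟩ _ ⟨x', hx', y', hy', hxy', rfl⟩ h
    rw [restricted_ran hxy, restricted_ran hxy'] at h
    obtain rfl := hX.3 _ hx _ hx' h
    obtain rfl := hY.3 _ hy _ hy' (hxy.symm.trans hxy')
    rfl

theorem IsBisection.inv {X : Set S} (hX : IsBisection X) : IsBisection X⁻¹ := by
  refine ⟨fun h => hX.1 ?_, fun a ha b hb h => inv_injective (hX.3 _ ha _ hb ?_),
    fun a ha b hb h => inv_injective (hX.2 _ ha _ hb ?_)⟩
  · rwa [mem_inv_set, inv_zero_eq] at h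
  · simpa only [inv_inv_eq] using h
  · simpa only [inv_inv_eq] using h

theorem IsBisection.resMul_inv_resMul {X : Set S} (hX : IsBisection X) :
    Booleanization.resMul (Booleanization.resMul X X⁻¹) X = X := by
  ext a
  constructor
  · rintro ⟨_, ⟨x, hx, y, hy, hxy, rfl⟩, z, hz, hyz, rfl⟩
    rw [restricted_dom hxy] at hyz
    have h1 : x = y⁻¹ := hX.2 _ hx _ hy (by rw [inv_inv_eq, hxy])
    have h2 : y⁻¹ = z := hX.3 _ hy _ hz (by rw [inv_inv_eq, hyz])
    subst h1
    rw [h2, ← inv_inv_eq y, h2, mul_inv_mul]; exact hz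
  · intro ha
    refine ⟨a * a⁻¹, ⟨a, ha, a⁻¹, inv_mem_inv.2 ha, by rw [inv_inv_eq], rfl⟩, a, ha, ?_,
      (mul_inv_mul a).symm⟩
    rw [idem_inv (idem_mul_inv a), (idem_mul_inv a).eq]

/-- Write `x` as a restricted product `a * y * b`. Then `b` has the domain of `x` and `a` has its
range, so both equal `x`, which forces `y = x⁻¹`. Uniqueness of inverses in `Bis S` follows from
this. -/
theorem IsBisection.inv_mem_of_resMul {X Y : Set S} (hX : IsBisection X)
    (h : Booleanization.resMul (Booleanization.resMul X Y) X = X) {x : S} (hx : x ∈ X) :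
    x⁻¹ ∈ Y := by
  have hx' := hx
  rw [← h] at hx'
  obtain ⟨_, ⟨a, ha, y, hy, hay, rfl⟩, b, hb, hyb, hxe⟩ := hx'
  have hyb' := hyb
  rw [restricted_dom hay] at hyb'
  have h1 : x = b := hX.2 _ hx _ hb (by rw [hxe, restricted_dom hyb])
  have h2 : x = a := hX.3 _ hx _ ha (by rw [hxe, restricted_ran hyb, restricted_ran hay])
  subst h1
  subst h2
  have : y = x⁻¹ := by
    calc y = (y * y⁻¹) * y * (y⁻¹ * y) := by rw [mul_inv_mul, ← mul_assoc, mul_inv_mul]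
      _ = x⁻¹ * (x * y * x) * x⁻¹ := by rw [← hay, hyb']; simp only [mul_assoc]
      _ = x⁻¹ := by rw [← hxe, inv_mul_inv]
  exact this ▸ hy

theorem IsBisection.idem_of_resMul_self {X : Set S} (hX : IsBisection X)
    (h : Booleanization.resMul X X = X) {x : S} (hx : x ∈ X) : IsIdempotentElem x := by
  have hx' := hx
  rw [← h] at hx'
  obtain ⟨a, ha, b, hb, hab, hxe⟩ := hx'
  have h1 : x = b := hX.2 _ hx _ hb (by rw [hxe, restricted_dom hab])
  have h2 : x = a := hX.3 _ hx _ ha (by rw [hxe, restricted_ran hab])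
  rw [← h1, ← h2] at hxe
  exact hxe.symm

/-- Idempotents are the identities of the groupoid: two of them are composable only if they are
equal. -/
theorem resMul_idem_eq_inter {X Y : Set S} (hX : ∀ x ∈ X, IsIdempotentElem x)
    (hY : ∀ x ∈ Y, IsIdempotentElem x) : resMul X Y = X ∩ Y := by
  ext a
  constructor
  · rintro ⟨x, hx, y, hy, h, rfl⟩
    have hi := hX x hx
    have hi' := hY y hy
    rw [idem_inv hi, idem_inv hi', hi.eq, hi'.eq] at h
    subst h
    rw [hi.eq]; exact ⟨hx, hy⟩
  · rintro ⟨hx, hy⟩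
    have hi := hX a hx
    exact ⟨a, hx, a, hy, by rw [idem_inv hi], hi.eq.symm⟩

theorem IsBisection.of_idem {X : Set S} (h0 : (0 : S) ∉ X) (hX : ∀ x ∈ X, IsIdempotentElem x) :
    IsBisection X := by
  refine ⟨h0, fun a ha b hb h => ?_, fun a ha b hb h => ?_⟩ <;>
  · rw [idem_inv (hX a ha), idem_inv (hX b hb), (hX a ha).eq, (hX b hb).eq] at h
    exact h

/-- If `a ∈ X` and `b ∈ Y` have the same domain, then `a * b⁻¹` is a restricted product, so it is
idempotent and `a = b`. For equal ranges use `a⁻¹ * b`. -/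
theorem IsBisection.union {X Y : Set S} (hX : IsBisection X) (hY : IsBisection Y)
    (h1 : ∀ p ∈ Booleanization.resMul X⁻¹ Y, IsIdempotentElem p)
    (h2 : ∀ p ∈ Booleanization.resMul X Y⁻¹, IsIdempotentElem p) : IsBisection (X ∪ Y) := by
  have d : ∀ a ∈ X, ∀ b ∈ Y, a⁻¹ * a = b⁻¹ * b → a = b := fun a ha b hb h =>
    eq_of_mul_inv_idem (h2 _ ⟨a, ha, b⁻¹, inv_mem_inv.2 hb, by rw [h, inv_inv_eq], rfl⟩) h
  have r : ∀ a ∈ X, ∀ b ∈ Y, a * a⁻¹ = b * b⁻¹ → a = b := fun a ha b hb h =>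
    eq_of_inv_mul_idem (h1 _ ⟨a⁻¹, inv_mem_inv.2 ha, b, hb, by rw [inv_inv_eq, h], rfl⟩) h
  refine ⟨fun h => h.elim hX.1 hY.1, ?_, ?_⟩
  · rintro a (ha | ha) b (hb | hb) h
    exacts [hX.2 a ha b hb h, d a ha b hb h, (d b hb a ha h.symm).symm, hY.2 a ha b hb h]
  · rintro a (ha | ha) b (hb | hb) h
    exacts [hX.3 a ha b hb h, r a ha b hb h, (r b hb a ha h.symm).symm, hY.3 a ha b hb h]

/-- Products `x⁻¹y` inside a bisection are idempotent. -/
theorem IsBisection.idem_inv_resMul {X : Set S} (hX : IsBisection X) {p : S}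
    (hp : p ∈ Booleanization.resMul X⁻¹ X) : IsIdempotentElem p := by
  obtain ⟨x, hx, y, hy, hxy, rfl⟩ := hp
  have : x⁻¹ = y := hX.3 _ hx _ hy (by rw [inv_inv_eq, hxy])
  rw [← this]; exact idem_mul_inv x

theorem IsBisection.idem_resMul_inv {X : Set S} (hX : IsBisection X) {p : S}
    (hp : p ∈ Booleanization.resMul X X⁻¹) : IsIdempotentElem p := by
  have := hX.inv.idem_inv_resMul (p := p)
  rw [inv_inv_set] at this
  exact this hp

end Groupoid

/-! ### Cones and constructible sets -/

section Cones

variable {S : Type u} [InverseSemigroupWithZero S]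

open InverseSemigroupWithZero

/-- The nonzero elements below `s` that are not below `s * e` for any `e ∈ L`. -/
def cone (s : S) (L : Set S) : Set S := {r | r ≠ 0 ∧ NatLE r s ∧ ∀ e ∈ L, r * e ≠ r}

/-- Cones that are given by finitely many idempotents. -/
def IsCone (X : Set S) : Prop :=
  ∃ (s : S) (L : Set S), L.Finite ∧ (∀ e ∈ L, IsIdempotentElem e) ∧ X = cone s L

/-- Finite unions of cones. -/
def Constructible (X : Set S) : Prop :=
  ∃ F : Set (Set S), F.Finite ∧ (∀ Y ∈ F, IsCone Y) ∧ X = ⋃₀ F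

theorem IsCone.constructible {X : Set S} (h : IsCone X) : Constructible X :=
  ⟨{X}, Set.finite_singleton X, by rintro _ rfl; exact h, (Set.sUnion_singleton X).symm⟩

theorem isCone_cone {s : S} {L : Set S} (hL : L.Finite) (hi : ∀ e ∈ L, IsIdempotentElem e) :
    IsCone (cone s L) := ⟨s, L, hL, hi, rfl⟩

theorem constructible_cone {s : S} {L : Set S} (hL : L.Finite)
    (hi : ∀ e ∈ L, IsIdempotentElem e) : Constructible (cone s L) :=
  (isCone_cone hL hi).constructible

theorem constructible_empty : Constructible (∅ : Set S) :=
  ⟨∅, Set.finite_empty, by simp, by simp⟩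

theorem Constructible.union {X Y : Set S} (hX : Constructible X) (hY : Constructible Y) :
    Constructible (X ∪ Y) := by
  obtain ⟨F, hF, hFc, rfl⟩ := hX
  obtain ⟨G, hG, hGc, rfl⟩ := hY
  exact ⟨F ∪ G, hF.union hG, fun Z hZ => hZ.elim (hFc Z) (hGc Z), (Set.sUnion_union F G).symm⟩

theorem constructible_biUnion {ι : Type v} {I : Set ι} (hI : I.Finite) {f : ι → Set S}
    (hf : ∀ i ∈ I, Constructible (f i)) : Constructible (⋃ i ∈ I, f i) := by
  induction I, hI using Set.Finite.induction_on with
  | empty => simpa using constructible_empty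
  | insert _ _ ih =>
    rw [Set.biUnion_insert]
    exact (hf _ (Set.mem_insert _ _)).union (ih fun i hi => hf i (Set.mem_insert_of_mem _ hi))

theorem Constructible.zero_notMem {X : Set S} (hX : Constructible X) : (0 : S) ∉ X := by
  obtain ⟨F, -, hFc, rfl⟩ := hX
  rintro ⟨Y, hY, h0⟩
  obtain ⟨s, L, -, -, rfl⟩ := hFc Y hY
  exact h0.1 rfl

theorem Constructible.induction {P : (X : Set S) → Constructible X → Prop}
    (empty : P ∅ constructible_empty)
    (cone_union : ∀ (s : S) (L : Set S) (Y : Set S), L.Finite → (∀ e ∈ L, IsIdempotentElem e) →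
      ∀ hY : Constructible Y, P Y hY → ∀ h : Constructible (cone s L ∪ Y), P (cone s L ∪ Y) h)
    {X : Set S} (hX : Constructible X) : P X hX := by
  obtain ⟨F, hF, hFc, rfl⟩ := hX
  induction F, hF using Set.Finite.induction_on with
  | empty => simpa only [Set.sUnion_empty] using empty
  | @insert Y G _ hG ih =>
    have hGc : ∀ Y ∈ G, IsCone Y := fun Z hZ => hFc Z (Set.mem_insert_of_mem _ hZ)
    obtain ⟨s, L, hL, hi, rfl⟩ := hFc Y (Set.mem_insert _ _)
    simp only [Set.sUnion_insert]
    exact cone_union s L _ hL hi ⟨G, hG, hGc, rfl⟩ (ih hGc) _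

theorem cone_subset_of_subset {s : S} {L M : Set S} (h : L ⊆ M) : cone s M ⊆ cone s L :=
  fun _ hr => ⟨hr.1, hr.2.1, fun e he => hr.2.2 e (h he)⟩

theorem isBisection_of_compatible {X : Set S} (h0 : (0 : S) ∉ X)
    (h : ∀ a ∈ X, ∀ b ∈ X, Compatible a b) : IsBisection X :=
  ⟨h0, fun a ha b hb => eq_of_mul_inv_idem (h a ha b hb).2,
    fun a ha b hb => eq_of_inv_mul_idem (h a ha b hb).1⟩

theorem isBisection_cone (s : S) (L : Set S) : IsBisection (cone s L) :=
  isBisection_of_compatible (fun h => h.1 rfl)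
    fun _ ha _ hb => compatible_of_common_bound ha.2.1 hb.2.1

/-- Conditions on the right factor persist, because a restricted product has the domain of its right
factor. A condition `e` on the left factor becomes its conjugate by `t`. Conversely, an element
below `s * t` is factored as in `mul_inv_mul_mul_cancel`. -/
theorem resMul_cone (s t : S) (L M : Set S) (hL : ∀ e ∈ L, IsIdempotentElem e) :
    resMul (cone s L) (cone t M) = cone (s * t) ((fun e => t⁻¹ * e * t) '' L ∪ M) := by
  ext p
  constructor
  · rintro ⟨r, ⟨hr0, hrs, hrL⟩, q, ⟨hq0, hqt, hqM⟩, hrq, rfl⟩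
    refine ⟨restricted_ne_zero hrq hr0, natLE_mul hrs hqt, ?_⟩
    have hr : r * q * q⁻¹ = r := by rw [mul_assoc, ← hrq, ← mul_assoc, mul_inv_mul]
    rintro e' (⟨e, he, rfl⟩ | he) h
    · apply hrL e he
      have h1 : r * q * (t⁻¹ * e * t) * q⁻¹ = r := by rw [h, hr]
      calc r * e = r * (q * q⁻¹) * e := by rw [← mul_assoc, hr]
        _ = r * e * (q * q⁻¹) := mul_idem_comm (idem_mul_inv q) (hL e he) r
        _ = r * (q * q⁻¹) * e * (q * q⁻¹) := by rw [← mul_assoc r q, hr]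
        _ = r * (q * t⁻¹) * e * (t * q⁻¹) := by
          rw [mul_inv_of_natLE hqt, ← mul_inv_of_natLE (natLE_refl q)]
          have : t * q⁻¹ = q * q⁻¹ := by
            have := mul_inv_of_natLE hqt
            rw [← idem_inv (idem_mul_inv q), ← this, mul_inv_eq, inv_inv_eq]
          rw [this]
        _ = r * q * (t⁻¹ * e * t) * q⁻¹ := by simp only [mul_assoc]
        _ = r := h1
    · apply hqM e' he
      calc q * e' = q * q⁻¹ * q * e' := by rw [mul_inv_mul]
        _ = r⁻¹ * (r * q * e') := by rw [← hrq]; simp only [mul_assoc]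
        _ = q := by rw [h, ← mul_assoc, hrq, mul_inv_mul]
  · rintro ⟨hp0, hp, hpL⟩
    have hpp := mul_inv_mul_mul_cancel t p hp
    refine ⟨p * t⁻¹, ⟨?_, mul_inv_natLE hp, ?_⟩, t * (p⁻¹ * p), ⟨?_, ?_, ?_⟩, ?_, hpp.symm⟩
    · intro h
      rw [h, zero_mul] at hpp
      exact hp0 hpp.symm
    · intro e he h
      apply hpL _ (Or.inl ⟨e, he, rfl⟩)
      calc p * (t⁻¹ * e * t) = p * t⁻¹ * e * t := by simp only [mul_assoc]
        _ = p := by rw [h, mul_mul_inv_mul_cancel t p hp]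
    · intro h
      rw [h, mul_zero] at hpp
      exact hp0 hpp.symm
    · exact natLE_mul_idem (idem_inv_mul p) t
    · intro e he h
      apply hpL e (Or.inr he)
      rw [← hpp, mul_assoc, h]
    · exact conj_inv_mul t p

theorem inv_mul_conj {a e : S} (he : IsIdempotentElem e) {s : S} (has : NatLE a s) :
    a⁻¹ * (s * e * s⁻¹) = (a * e)⁻¹ := by
  calc a⁻¹ * (s * e * s⁻¹) = (a⁻¹ * s) * e * s⁻¹ := by simp only [mul_assoc]
    _ = (a⁻¹ * a) * e * s⁻¹ := by
      have := mul_inv_of_natLE (natLE_inv has)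
      rw [inv_inv_eq, inv_inv_eq] at this
      rw [this]
    _ = e * (a⁻¹ * (a * s⁻¹)) := by
      rw [idem_comm (idem_inv_mul a) he]; simp only [mul_assoc]
    _ = e * a⁻¹ := by rw [mul_inv_of_natLE has, ← mul_assoc a⁻¹, inv_mul_inv]
    _ = (a * e)⁻¹ := by rw [mul_inv_eq, idem_inv he]

theorem mul_inv_conj {a e : S} (he : IsIdempotentElem e) {s : S} (has : NatLE a s) :
    a⁻¹ * (s * e * s⁻¹) = a⁻¹ ↔ a * e = a := by
  rw [inv_mul_conj he has]
  exact ⟨inv_injective, fun h => by rw [h]⟩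

/-- The conditions concern domains, which inversion exchanges with ranges; conjugation by `s` moves
them back to the domains. -/
theorem inv_cone (s : S) (L : Set S) (hL : ∀ e ∈ L, IsIdempotentElem e) :
    (cone s L)⁻¹ = cone s⁻¹ ((fun e => s * e * s⁻¹) '' L) := by
  ext a
  constructor
  · rintro ⟨h0, hle, h⟩
    refine ⟨fun h => h0 (inv_eq_zero_iff.2 h), by simpa only [inv_inv_eq] using natLE_inv hle, ?_⟩
    rintro _ ⟨e, he, rfl⟩ h'
    have := (mul_inv_conj (hL e he) hle).1
    rw [inv_inv_eq] at this
    exact h e he (this h')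
  · rintro ⟨h0, hle, h⟩
    have hle' : NatLE a⁻¹ s := by simpa only [inv_inv_eq] using natLE_inv hle
    refine ⟨fun h => h0 (inv_eq_zero_iff.1 h), hle', fun e he h' => ?_⟩
    apply h _ ⟨e, he, rfl⟩
    have := (mul_inv_conj (hL e he) hle').2 h'
    rwa [inv_inv_eq] at this

theorem IsCone.resMul {X Y : Set S} (hX : IsCone X) (hY : IsCone Y) : IsCone (resMul X Y) := by
  obtain ⟨s, L, hL, hi, rfl⟩ := hX
  obtain ⟨t, M, hM, hj, rfl⟩ := hY
  rw [resMul_cone s t L M hi]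
  refine isCone_cone ((hL.image _).union hM) ?_
  rintro _ (⟨e, he, rfl⟩ | he)
  · exact idem_conj' t (hi e he)
  · exact hj _ he

theorem IsCone.inv {X : Set S} (hX : IsCone X) : IsCone X⁻¹ := by
  obtain ⟨s, L, hL, hi, rfl⟩ := hX
  rw [inv_cone s L hi]
  refine isCone_cone (hL.image _) ?_
  rintro _ ⟨e, he, rfl⟩
  exact idem_conj s (hi e he)

theorem resMul_sUnion (F G : Set (Set S)) :
    resMul (⋃₀ F) (⋃₀ G) = ⋃₀ Set.image2 resMul F G := by
  ext p
  constructor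
  · rintro ⟨r, ⟨X, hX, hr⟩, q, ⟨Y, hY, hq⟩, h, rfl⟩
    exact ⟨resMul X Y, ⟨X, hX, Y, hY, rfl⟩, r, hr, q, hq, h, rfl⟩
  · rintro ⟨_, ⟨X, hX, Y, hY, rfl⟩, r, hr, q, hq, h, rfl⟩
    exact ⟨r, ⟨X, hX, hr⟩, q, ⟨Y, hY, hq⟩, h, rfl⟩

theorem Constructible.resMul {X Y : Set S} (hX : Constructible X) (hY : Constructible Y) :
    Constructible (resMul X Y) := by
  obtain ⟨F, hF, hFc, rfl⟩ := hX
  obtain ⟨G, hG, hGc, rfl⟩ := hY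
  rw [resMul_sUnion]
  refine ⟨_, hF.image2 _ hG, ?_, rfl⟩
  rintro _ ⟨X, hX, Y, hY, rfl⟩
  exact (hFc X hX).resMul (hGc Y hY)

theorem Constructible.inv {X : Set S} (hX : Constructible X) : Constructible X⁻¹ := by
  obtain ⟨F, hF, hFc, rfl⟩ := hX
  refine ⟨(fun Y => Y⁻¹) '' F, hF.image _, ?_, ?_⟩
  · rintro _ ⟨Y, hY, rfl⟩
    exact (hFc Y hY).inv
  · ext a
    constructor
    · rintro ⟨Y, hY, ha⟩
      exact ⟨Y⁻¹, ⟨Y, hY, rfl⟩, ha⟩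
    · rintro ⟨_, ⟨Y, hY, rfl⟩, ha⟩
      exact ⟨Y, hY, ha⟩

/-- If `s * e = s`, then `r * e = r` for all `r ≤ s`, so the apex satisfies the conditions as soon
as some element does. Hence a nonempty cone of idempotents has an idempotent apex. -/
theorem self_mem_cone {s r : S} {L : Set S} (hL : ∀ e ∈ L, IsIdempotentElem e)
    (hr : r ∈ cone s L) : s ∈ cone s L :=
  ⟨fun h => hr.1 (eq_zero_of_natLE (h ▸ hr.2.1)), natLE_refl s,
    fun e he h => hr.2.2 e he (mul_eq_self_of_natLE hr.2.1 (hL e he) h)⟩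

/-- An idempotent of the first cone can avoid the second one in two ways: either it is not below
`f`, which is a further condition, or it is below some `g ∈ M`, and then the apex shrinks to `s *
g`. -/
theorem constructible_cone_diff_cone {s f : S} {L M : Set S} (hL : L.Finite)
    (hLi : ∀ e ∈ L, IsIdempotentElem e) (hM : M.Finite) (hMi : ∀ e ∈ M, IsIdempotentElem e)
    (hs : ∀ x ∈ cone s L, IsIdempotentElem x) (hf : ∀ x ∈ cone f M, IsIdempotentElem x) :
    Constructible (cone s L \ cone f M) := by
  -- If this cone is empty, its apex `f` need not be idempotent and could not serve as a condition.
  rcases Set.eq_empty_or_nonempty (cone f M) with h0 | ⟨x, hx⟩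
  · rw [h0, Set.sdiff_empty]
    exact constructible_cone hL hLi
  have hfi := hf f (self_mem_cone hMi hx)
  have : cone s L \ cone f M = cone s (insert f L) ∪ ⋃ g ∈ M, cone (s * g) L := by
    ext r
    constructor
    · rintro ⟨hr, hr'⟩
      by_cases h1 : r * f = r
      · by_contra h2
        refine hr' ⟨hr.1, ⟨r, hs r hr, ?_⟩, fun e he h3 => h2 (Or.inr ?_)⟩
        · rw [← idem_comm (hs r hr) hfi, h1]
        · exact Set.mem_biUnion he ⟨hr.1, natLE_mul_of_mul_eq hr.2.1 h3, hr.2.2⟩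
      · refine Or.inl ⟨hr.1, hr.2.1, ?_⟩
        rintro e (rfl | he)
        exacts [h1, hr.2.2 e he]
    · rintro (hr | hr)
      · refine ⟨cone_subset_of_subset (Set.subset_insert f L) hr, fun h => ?_⟩
        exact hr.2.2 f (Set.mem_insert _ _) (mul_eq_self_of_natLE h.2.1 hfi hfi.eq)
      · obtain ⟨g, hg, hr⟩ := Set.mem_iUnion₂.1 hr
        refine ⟨⟨hr.1, natLE_trans hr.2.1 (natLE_mul_idem (hMi g hg) s), hr.2.2⟩, fun h => ?_⟩
        exact h.2.2 g hg (mul_eq_self_of_natLE hr.2.1 (hMi g hg)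
          (mul_idem_mul_idem (hMi g hg) s))
  rw [this]
  refine (constructible_cone (hL.insert f) ?_).union
    (constructible_biUnion hM fun g _ => constructible_cone hL hLi)
  rintro e (rfl | he)
  exacts [hfi, hLi e he]

/-- Set differences of constructible sets of idempotents are constructible. -/
theorem Constructible.diff {X Y : Set S} (hX : Constructible X) (hY : Constructible Y)
    (hXi : ∀ x ∈ X, IsIdempotentElem x) (hYi : ∀ x ∈ Y, IsIdempotentElem x) :
    Constructible (X \ Y) := by
  have step : ∀ (f : S) (M : Set S), M.Finite → (∀ e ∈ M, IsIdempotentElem e) →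
      (∀ x ∈ cone f M, IsIdempotentElem x) → ∀ X : Set S, Constructible X →
      (∀ x ∈ X, IsIdempotentElem x) → Constructible (X \ cone f M) := by
    intro f M hM hMi hf X hX hXi
    induction hX using Constructible.induction with
    | empty => simpa using constructible_empty
    | cone_union s L Y hL hLi hY ih _ =>
      rw [Set.union_sdiff_distrib]
      exact (constructible_cone_diff_cone hL hLi hM hMi (fun x hx => hXi x (Or.inl hx)) hf).union
        (ih fun x hx => hXi x (Or.inr hx))
  induction hY using Constructible.induction generalizing X with
  | empty => simpa using hX
  | cone_union f M Y hM hMi hY ih _ =>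
    rw [← Set.sdiff_sdiff]
    exact ih (step f M hM hMi (fun x hx => hYi x (Or.inl hx)) X hX hXi)
      (fun x hx => hXi x hx.1) (fun x hx => hYi x (Or.inr hx))

end Cones

/-! ### The Boolean inverse semigroup of constructible bisections -/

section Booleanization

variable (S : Type u) [InverseSemigroupWithZero S]

open InverseSemigroupWithZero

/-- The Booleanization, realized as the constructible bisections of the groupoid of nonzero
elements of `S`. -/
def Bis : Type u := {X : Set S // Constructible X ∧ IsBisection X}

variable {S}

instance : Mul (Bis S) where
  mul X Y := ⟨resMul X.1 Y.1, X.2.1.resMul Y.2.1, X.2.2.resMul Y.2.2⟩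

instance : Inv (Bis S) where
  inv X := ⟨X.1⁻¹, X.2.1.inv, X.2.2.inv⟩

instance : Zero (Bis S) where
  zero := ⟨∅, constructible_empty, ⟨by simp, by simp, by simp⟩⟩

theorem Bis.mul_val (X Y : Bis S) : (X * Y).1 = resMul X.1 Y.1 := rfl
theorem Bis.zero_val : (0 : Bis S).1 = ∅ := rfl
instance : InverseSemigroupWithZero (Bis S) where
  mul_assoc X Y Z := Subtype.ext (resMul_assoc X.1 Y.1 Z.1)
  zero_mul X := by
    apply Subtype.ext
    rw [Bis.mul_val, Bis.zero_val, Set.eq_empty_iff_forall_notMem]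
    rintro p ⟨r, hr, -⟩
    exact hr
  mul_zero X := by
    apply Subtype.ext
    rw [Bis.mul_val, Bis.zero_val, Set.eq_empty_iff_forall_notMem]
    rintro p ⟨r, -, q, hq, -⟩
    exact hq
  mul_inv_mul X := Subtype.ext X.2.2.resMul_inv_resMul
  inv_mul_inv X := by
    apply Subtype.ext
    have := X.2.2.inv.resMul_inv_resMul
    rwa [inv_inv_set] at this
  inv_unique X Y h1 h2 := by
    apply Subtype.ext
    have h1 := congrArg Subtype.val h1
    have h2 := congrArg Subtype.val h2
    ext y
    constructor
    · exact fun hy => Y.2.2.inv_mem_of_resMul h2 hy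
    · intro hy
      have := X.2.2.inv_mem_of_resMul h1 hy
      rwa [inv_inv_eq] at this

theorem Bis.isIdempotentElem_iff {X : Bis S} :
    IsIdempotentElem X ↔ ∀ x ∈ X.1, IsIdempotentElem x := by
  constructor
  · exact fun h x hx => X.2.2.idem_of_resMul_self (congrArg Subtype.val h.eq) hx
  · intro h
    apply Subtype.ext
    rw [mul_val, resMul_idem_eq_inter h h, Set.inter_self]

/-- Multiplying `Y` by a set of idempotents keeps the elements whose domain lies in that set. If `X
⊆ Y`, then the domains of `X` cut out exactly `X`, since domains are injective on `Y`. -/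
theorem Bis.natLE_iff {X Y : Bis S} : NatLE X Y ↔ X.1 ⊆ Y.1 := by
  constructor
  · rintro ⟨E, hE, rfl⟩ _ ⟨y, hy, e, he, h, rfl⟩
    have hi := isIdempotentElem_iff.1 hE e he
    rw [idem_inv hi, hi.eq] at h
    rw [← h, ← mul_assoc, mul_inv_mul]
    exact hy
  · intro h
    have hi := idem_inv_mul X
    refine ⟨X⁻¹ * X, hi, Subtype.ext ?_⟩
    ext p
    constructor
    · intro hp
      refine ⟨p, h hp, p⁻¹ * p, ⟨p⁻¹, inv_mem_inv.2 hp, p, hp, by rw [inv_inv_eq], rfl⟩, ?_, ?_⟩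
      · rw [idem_inv (idem_inv_mul p), (idem_inv_mul p).eq]
      · rw [← mul_assoc, mul_inv_mul]
    · rintro ⟨y, hy, _, ⟨a, ha, b, hb, hab, rfl⟩, hyab, rfl⟩
      rw [restricted_ran hab] at hyab
      have h1 : y = a⁻¹ := Y.2.2.2 _ hy _ (h ha) (by rw [hyab, inv_inv_eq])
      have h2 : a⁻¹ = b := X.2.2.3 _ ha _ hb (by rw [inv_inv_eq, hab])
      rw [h1, h2, ← inv_inv_eq a, h2, ← mul_assoc, mul_inv_mul]
      exact hb

theorem Bis.isBisection_union_of_compatible {X Y : Bis S} (h : Compatible X Y) :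
    IsBisection (X.1 ∪ Y.1) :=
  X.2.2.union Y.2.2 (fun p hp => isIdempotentElem_iff.1 h.1 p hp)
    (fun p hp => isIdempotentElem_iff.1 h.2 p hp)

theorem Bis.compatible_of_isBisection_union {X Y : Bis S} (h : IsBisection (X.1 ∪ Y.1)) :
    Compatible X Y := by
  constructor
  · refine isIdempotentElem_iff.2 fun p hp => h.idem_inv_resMul (resMul_mono ?_ ?_ hp)
    · exact fun a ha => Or.inl ha
    · exact fun a ha => Or.inr ha
  · refine isIdempotentElem_iff.2 fun p hp => h.idem_resMul_inv (resMul_mono ?_ ?_ hp)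
    · exact fun a ha => Or.inl ha
    · exact fun a ha => Or.inr ha

/-- The join of a compatible pair. -/
def Bis.sup (X Y : Bis S) (h : Compatible X Y) : Bis S :=
  ⟨X.1 ∪ Y.1, X.2.1.union Y.2.1, isBisection_union_of_compatible h⟩

theorem Bis.isJoin_of_val_eq {X Y Z : Bis S} (h : Z.1 = X.1 ∪ Y.1) : IsJoin X Y Z := by
  refine ⟨natLE_iff.2 ?_, natLE_iff.2 ?_, fun W hX hY => natLE_iff.2 ?_⟩
  · rw [h]; exact Set.subset_union_left
  · rw [h]; exact Set.subset_union_right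
  · rw [h]; exact Set.union_subset (natLE_iff.1 hX) (natLE_iff.1 hY)

theorem IsJoin.unique {a b c d : S} (h : IsJoin a b c) (h' : IsJoin a b d) : c = d :=
  natLE_antisymm (h.2.2 d h'.1 h'.2.1) (h'.2.2 c h.1 h.2.1)

theorem Bis.isJoin_iff {X Y Z : Bis S} (h : Compatible X Y) :
    IsJoin X Y Z ↔ Z.1 = X.1 ∪ Y.1 := by
  refine ⟨fun hj => ?_, isJoin_of_val_eq⟩
  rw [hj.unique (isJoin_of_val_eq (Z := sup X Y h) rfl)]
  rfl

theorem resMul_union (X Y Z : Set S) : resMul X (Y ∪ Z) = resMul X Y ∪ resMul X Z := by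
  ext p
  constructor
  · rintro ⟨x, hx, y, hy | hy, h⟩
    exacts [Or.inl ⟨x, hx, y, hy, h⟩, Or.inr ⟨x, hx, y, hy, h⟩]
  · rintro (⟨x, hx, y, hy, h⟩ | ⟨x, hx, y, hy, h⟩)
    exacts [⟨x, hx, y, Or.inl hy, h⟩, ⟨x, hx, y, Or.inr hy, h⟩]

theorem union_resMul (X Y Z : Set S) : resMul (X ∪ Y) Z = resMul X Z ∪ resMul Y Z := by
  ext p
  constructor
  · rintro ⟨x, hx | hx, y, hy, h⟩
    exacts [Or.inl ⟨x, hx, y, hy, h⟩, Or.inr ⟨x, hx, y, hy, h⟩]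
  · rintro (⟨x, hx, y, hy, h⟩ | ⟨x, hx, y, hy, h⟩)
    exacts [⟨x, Or.inl hx, y, hy, h⟩, ⟨x, Or.inr hx, y, hy, h⟩]

instance : DistributiveInverseSemigroup (Bis S) where
  exists_join X Y h := ⟨Bis.sup X Y h, Bis.isJoin_of_val_eq rfl⟩
  mul_join X Y Z W h hj := by
    apply Bis.isJoin_of_val_eq
    rw [Bis.mul_val, (Bis.isJoin_iff h).1 hj, resMul_union]
    rfl
  join_mul X Y Z W h hj := by
    apply Bis.isJoin_of_val_eq
    rw [Bis.mul_val, (Bis.isJoin_iff h).1 hj, union_resMul]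
    rfl

/-- An idempotent of `Bis S`, from a constructible set of idempotents. -/
def Bis.ofIdem (X : Set S) (hX : Constructible X) (h : ∀ x ∈ X, IsIdempotentElem x) :
    {E : Bis S // IsIdempotentElem E} :=
  ⟨⟨X, hX, IsBisection.of_idem hX.zero_notMem h⟩, Bis.isIdempotentElem_iff.2 h⟩

theorem Bis.idem_of_mem (E : {E : Bis S // IsIdempotentElem E}) {x : S} (hx : x ∈ E.1.1) :
    IsIdempotentElem x := isIdempotentElem_iff.1 E.2 x hx

theorem Bis.idem_inter_constructible (E F : {E : Bis S // IsIdempotentElem E}) :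
    Constructible (E.1.1 ∩ F.1.1) := by
  rw [← resMul_idem_eq_inter (fun _ => idem_of_mem E) (fun _ => idem_of_mem F)]
  exact E.1.2.1.resMul F.1.2.1

/-- The idempotents of `Bis S` form a generalized Boolean algebra of sets. -/
abbrev Bis.idempotentsBoolean : GeneralizedBooleanAlgebra {E : Bis S // IsIdempotentElem E} :=
  letI : Max {E : Bis S // IsIdempotentElem E} := ⟨fun E F => ofIdem (E.1.1 ∪ F.1.1)
    (E.1.2.1.union F.1.2.1) fun _ hx => hx.elim (idem_of_mem E) (idem_of_mem F)⟩
  letI : Min {E : Bis S // IsIdempotentElem E} := ⟨fun E F => ofIdem (E.1.1 ∩ F.1.1)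
    (idem_inter_constructible E F) fun _ hx => idem_of_mem E hx.1⟩
  letI : LE {E : Bis S // IsIdempotentElem E} := ⟨fun E F => E.1.1 ⊆ F.1.1⟩
  letI : LT {E : Bis S // IsIdempotentElem E} := ⟨fun E F => E.1.1 ⊂ F.1.1⟩
  letI : Bot {E : Bis S // IsIdempotentElem E} := ⟨⟨0, idem_zero⟩⟩
  letI : SDiff {E : Bis S // IsIdempotentElem E} := ⟨fun E F => ofIdem (E.1.1 \ F.1.1)
    (E.1.2.1.diff F.1.2.1 (fun _ => idem_of_mem E) fun _ => idem_of_mem F)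
    fun _ hx => idem_of_mem E hx.1⟩
  Function.Injective.generalizedBooleanAlgebra
    (fun E : {E : Bis S // IsIdempotentElem E} => E.1.1)
    (fun _ _ h => Subtype.ext (Subtype.ext h)) Iff.rfl Iff.rfl (fun _ _ => rfl) (fun _ _ => rfl)
    rfl (fun _ _ => rfl)

instance : BooleanInverseSemigroup (Bis S) where
  idempotents_boolean := ⟨Bis.idempotentsBoolean, fun _ _ => Bis.natLE_iff.symm⟩

theorem cone_empty_mul (s t : S) : resMul (cone s ∅) (cone t ∅) = cone (s * t) ∅ := by
  rw [resMul_cone s t ∅ ∅ (by simp), Set.image_empty, Set.empty_union]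

/-- The set of nonzero elements below `s`, as an element of the Booleanization. -/
def Bis.of (s : S) : Bis S :=
  ⟨cone s ∅, constructible_cone Set.finite_empty (by simp), isBisection_cone s ∅⟩

theorem mem_cone_empty {r s : S} : r ∈ cone s ∅ ↔ r ≠ 0 ∧ NatLE r s := by
  simp [cone]

variable (S) in
/-- The embedding into the Booleanization. -/
def Bis.beta : Hom S (Bis S) where
  toFun := Bis.of
  map_mul' s t := Subtype.ext (cone_empty_mul s t).symm
  map_zero' := by
    apply Subtype.ext
    ext r
    change r ∈ cone 0 ∅ ↔ r ∈ (∅ : Set S)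
    rw [mem_cone_empty]
    exact ⟨fun h => h.1 (eq_zero_of_natLE h.2), fun h => h.elim⟩

/-- A nonzero `s` is the largest element of its own cone. -/
theorem Bis.beta_injective : Function.Injective (Bis.beta S) := by
  have key : ∀ s t : S, beta S s = beta S t → NatLE s t := by
    intro s t h
    by_cases hs : s = 0
    · rw [hs]; exact zero_natLE t
    · have h1 : s ∈ cone s ∅ := mem_cone_empty.2 ⟨hs, natLE_refl s⟩
      rw [show cone s ∅ = cone t ∅ from congrArg Subtype.val h] at h1
      exact h1.2.1
  exact fun s t h => natLE_antisymm (key s t h) (key t s h.symm)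

end Booleanization

/-! ### Relative complements -/

section RelativeComplements

variable {T : Type v} [InverseSemigroupWithZero T]

/-- The elements below `x` that are orthogonal to all elements of `L`. -/
def below (x : T) (L : Set T) : Set T := {z | NatLE z x ∧ ∀ e ∈ L, z * e = 0}

/-- `w` is the relative complement `x \ ⋁ L`. -/
def IsRelCompl (x : T) (L : Set T) (w : T) : Prop := w ∈ below x L ∧ ∀ z ∈ below x L, NatLE z w

theorem isRelCompl_empty (x : T) : IsRelCompl x ∅ x := ⟨⟨natLE_refl x, by simp⟩, fun _ h => h.1⟩

theorem IsRelCompl.unique {x w w' : T} {L : Set T} (hw : IsRelCompl x L w) (hw' : IsRelCompl x L w') :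
    w = w' := natLE_antisymm (hw'.2 w hw.1) (hw.2 w' hw'.1)

end RelativeComplements

/-! ### Finite joins in distributive inverse semigroups -/

section Joins

open InverseSemigroupWithZero DistributiveInverseSemigroup

variable {T : Type v} [DistributiveInverseSemigroup T]

/-- Idempotents below `j` are below `j * j⁻¹`, so their join `j` is below this idempotent. -/
theorem idem_of_isJoin {e f j : T} (he : IsIdempotentElem e) (hf : IsIdempotentElem f)
    (h : IsJoin e f j) : IsIdempotentElem j := by
  have key : ∀ {e : T}, IsIdempotentElem e → NatLE e j → NatLE e (j * j⁻¹) := by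
    intro e he hle
    have := natLE_mul hle (natLE_inv hle)
    rwa [idem_inv he, he.eq] at this
  exact idem_of_natLE (h.2.2 _ (key he h.1) (key hf h.2.1)) (idem_mul_inv j)

theorem IsJoin.inv {a b c : T} (h : IsJoin a b c) : IsJoin a⁻¹ b⁻¹ c⁻¹ := by
  refine ⟨natLE_inv h.1, natLE_inv h.2.1, fun d ha hb => ?_⟩
  rw [← inv_inv_eq d]
  rw [← inv_inv_eq d] at ha hb
  exact natLE_inv (h.2.2 _ (natLE_inv_iff.1 ha) (natLE_inv_iff.1 hb))

/-- By distributivity, `c⁻¹ * j` is the join of the idempotents `c⁻¹ * a` and `c⁻¹ * b`, and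
similarly for `c * j⁻¹`. -/
theorem compatible_join {a b c j : T} (hab : Compatible a b) (hca : Compatible c a)
    (hcb : Compatible c b) (h : IsJoin a b j) : Compatible c j :=
  ⟨idem_of_isJoin hca.1 hcb.1 (mul_join _ _ _ c⁻¹ hab h),
    idem_of_isJoin hca.2 hcb.2 (mul_join _ _ _ c (compatible_inv hab) h.inv)⟩

/-- Least upper bounds with respect to the natural partial order. -/
def IsSup (A : Set T) (y : T) : Prop :=
  (∀ a ∈ A, NatLE a y) ∧ ∀ d, (∀ a ∈ A, NatLE a d) → NatLE y d

theorem IsSup.unique {A : Set T} {y z : T} (hy : IsSup A y) (hz : IsSup A z) : y = z :=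
  natLE_antisymm (hy.2 z hz.1) (hz.2 y hy.1)

theorem isSup_empty : IsSup (∅ : Set T) 0 := ⟨by simp, fun d _ => zero_natLE d⟩

theorem IsSup.insert {A : Set T} {a y z : T} (hy : IsSup A y) (hz : IsJoin a y z) :
    IsSup (insert a A) z := by
  constructor
  · rintro b (rfl | hb)
    exacts [hz.1, natLE_trans (hy.1 b hb) hz.2.1]
  · intro d hd
    exact hz.2.2 d (hd a (Set.mem_insert _ _))
      (hy.2 d fun b hb => hd b (Set.mem_insert_of_mem _ hb))

/-- The induction needs the clause on compatibility in order to join the next element with the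
supremum already formed. Distributivity is proved along with existence, one binary join at a time.
-/
theorem exists_isSup {A : Set T} (hA : A.Finite) (hc : ∀ a ∈ A, ∀ b ∈ A, Compatible a b) :
    ∃ y, IsSup A y ∧ (∀ c, (∀ a ∈ A, Compatible c a) → Compatible c y) ∧
      (∀ c, IsSup ((fun a => c * a) '' A) (c * y)) ∧
      ∀ c, IsSup ((fun a => a * c) '' A) (y * c) := by
  induction A, hA using Set.Finite.induction_on with
  | empty =>
    refine ⟨0, isSup_empty, fun c _ => compatible_zero c, fun c => ?_, fun c => ?_⟩
    · rw [Set.image_empty, mul_zero]; exact isSup_empty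
    · rw [Set.image_empty, zero_mul]; exact isSup_empty
  | @insert a A _ _ ih =>
    obtain ⟨y, h1, h2, h3, h4⟩ :=
      ih fun b hb c hc' => hc b (Set.mem_insert_of_mem _ hb) c (Set.mem_insert_of_mem _ hc')
    have hay : Compatible a y :=
      h2 a fun b hb => hc a (Set.mem_insert _ _) b (Set.mem_insert_of_mem _ hb)
    obtain ⟨z, hz⟩ := exists_join a y hay
    refine ⟨z, h1.insert hz, fun c hcc => ?_, fun c => ?_, fun c => ?_⟩
    · exact compatible_join hay (hcc a (Set.mem_insert _ _))
        (h2 c fun b hb => hcc b (Set.mem_insert_of_mem _ hb)) hz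
    · rw [Set.image_insert_eq]
      exact (h3 c).insert (mul_join _ _ _ c hay hz)
    · rw [Set.image_insert_eq]
      exact (h4 c).insert (join_mul _ _ _ c hay hz)

theorem IsSup.mul {A B : Set T} (hA : A.Finite) (hAc : ∀ a ∈ A, ∀ b ∈ A, Compatible a b)
    (hB : B.Finite) (hBc : ∀ a ∈ B, ∀ b ∈ B, Compatible a b) {y z : T} (hy : IsSup A y)
    (hz : IsSup B z) : IsSup (Set.image2 (· * ·) A B) (y * z) := by
  obtain ⟨y', hy', -, -, hr⟩ := exists_isSup hA hAc
  obtain ⟨z', hz', -, hl, -⟩ := exists_isSup hB hBc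
  rw [hy.unique hy', hz.unique hz']
  constructor
  · rintro _ ⟨a, ha, b, hb, rfl⟩
    exact natLE_mul (hy'.1 a ha) (hz'.1 b hb)
  · intro d hd
    refine (hr z').2 d ?_
    rintro _ ⟨a, ha, rfl⟩
    refine (hl a).2 d ?_
    rintro _ ⟨b, hb, rfl⟩
    exact hd _ ⟨a, ha, b, hb, rfl⟩

/-- Multiply the join of `c * e` and `d` by the domain of `z`: then `z` is the join of `z * e = 0`
and a restriction of `d`. -/
theorem natLE_of_isJoin_of_mul_eq_zero {c d e z : T} (he : IsIdempotentElem e)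
    (h : IsJoin (c * e) d c) (hzc : NatLE z c) (hz : z * e = 0) : NatLE z d := by
  have hcd : Compatible (c * e) d := compatible_of_common_bound h.1 h.2.1
  have h1 := join_mul _ _ _ (z⁻¹ * z) hcd h
  rw [mul_inv_mul_of_natLE hzc, mul_idem_comm he (idem_inv_mul z),
    mul_inv_mul_of_natLE hzc, hz] at h1
  exact natLE_trans (h1.2.2 _ (zero_natLE _) (natLE_refl _)) (natLE_mul_idem (idem_inv_mul z) d)

end Joins

/-! ### Complements in Boolean inverse semigroups -/

section Complements

open InverseSemigroupWithZero DistributiveInverseSemigroup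

variable {T : Type v} [BooleanInverseSemigroup T]

/-- Take the Boolean difference for `g`: meets of idempotents are products and the bottom is zero. A
Boolean supremum is a bound among idempotents only, while `IsJoin` refers to all of `T`. The two
agree here because the join in `T` is itself idempotent. -/
theorem exists_compl_idem {e f : T} (he : IsIdempotentElem e) (hf : IsIdempotentElem f) :
    ∃ g, IsIdempotentElem g ∧ g * f = 0 ∧ IsJoin (e * f) g e := by
  obtain ⟨G, hG⟩ := BooleanInverseSemigroup.idempotents_boolean (S := T)
  let E : {e : T // IsIdempotentElem e} := ⟨e, he⟩
  let F : {e : T // IsIdempotentElem e} := ⟨f, hf⟩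
  have hle : ∀ {x y : {e : T // IsIdempotentElem e}}, x ≤ y ↔ NatLE x.1 y.1 := @fun x y => hG x y
  have hinf : ∀ x y : {e : T // IsIdempotentElem e}, (x ⊓ y).1 = x.1 * y.1 := by
    intro x y
    have h0 : NatLE (x ⊓ y).1 x.1 := hle.1 inf_le_left
    have h1 : NatLE (x ⊓ y).1 y.1 := hle.1 inf_le_right
    have h2 : (⟨x.1 * y.1, idem_mul x.2 y.2⟩ : {e : T // IsIdempotentElem e}) ≤ x ⊓ y :=
      le_inf (hle.2 (natLE_mul_idem y.2 x.1)) (hle.2 (natLE_idem_mul x.2 y.1))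
    refine natLE_antisymm ?_ (hle.1 h2)
    have := natLE_mul h0 h1
    rwa [(x ⊓ y).2.eq] at this
  have hbot : (⊥ : {e : T // IsIdempotentElem e}).1 = 0 :=
    eq_zero_of_natLE (hle.1 (bot_le (a := (⟨0, idem_zero⟩ : {e : T // IsIdempotentElem e}))))
  refine ⟨(E \ F).1, (E \ F).2, ?_, ?_⟩
  · rw [← hbot, ← inf_sdiff_self_left (x := F) (y := E), hinf]
  · obtain ⟨j, hj⟩ := exists_join (e * f) (E \ F).1 (compatible_of_idem (idem_mul he hf) (E \ F).2)
    have hji := idem_of_isJoin (idem_mul he hf) (E \ F).2 hj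
    have h1 : NatLE j e :=
      hj.2.2 e (natLE_mul_idem hf e) (hle.1 (sdiff_le : E \ F ≤ E))
    have h2 : E ≤ ⟨j, hji⟩ := by
      rw [← sup_inf_sdiff E F]
      refine sup_le (hle.2 ?_) (hle.2 hj.2.1)
      rw [hinf]
      exact hj.1
    rwa [natLE_antisymm h1 (hle.1 h2)] at hj

theorem exists_compl (x : T) {f : T} (hf : IsIdempotentElem f) :
    ∃ w, w * f = 0 ∧ IsJoin (x * f) w x := by
  obtain ⟨g, hg, hgf, hj⟩ := exists_compl_idem (idem_inv_mul x) hf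
  refine ⟨x * g, by rw [mul_assoc, hgf, mul_zero], ?_⟩
  have := mul_join _ _ _ x (compatible_of_idem (idem_mul (idem_inv_mul x) hf) hg) hj
  rwa [← mul_assoc, ← mul_assoc, mul_inv_mul] at this

/-- To bound `x`, it suffices to bound the elements below `x` that lie below or are orthogonal to
each of finitely many idempotents. -/
theorem natLE_of_forall_split {K : Set T} (hK : K.Finite) (hi : ∀ e ∈ K, IsIdempotentElem e)
    {x y : T} (h : ∀ z, NatLE z x → (∀ e ∈ K, z * e = z ∨ z * e = 0) → NatLE z y) :
    NatLE x y := by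
  induction K, hK using Set.Finite.induction_on generalizing x with
  | empty => exact h x (natLE_refl x) (by simp)
  | @insert f K _ _ ih =>
    have hf := hi f (Set.mem_insert _ _)
    have hK := fun e he => hi e (Set.mem_insert_of_mem f he)
    -- Both `x * f` and `w` are treated by induction; elements below the former absorb `f`, those
    -- below the latter are annihilated by it.
    obtain ⟨w, hw, hj⟩ := exists_compl x hf
    refine hj.2.2 y (ih hK fun z hz hze => h z (natLE_trans hz hj.1) ?_)
      (ih hK fun z hz hze => h z (natLE_trans hz hj.2.1) ?_)
    · rintro e (rfl | he)
      · exact Or.inl (mul_eq_self_of_natLE hz hf (mul_idem_mul_idem hf x))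
      · exact hze e he
    · rintro e (rfl | he)
      · exact Or.inr (mul_eq_zero_of_natLE hz hw)
      · exact hze e he

theorem IsRelCompl.insert {x w w' f : T} {L : Set T} (hw : IsRelCompl x L w) (hf : IsIdempotentElem f)
    (h0 : w' * f = 0) (hj : IsJoin (w * f) w' w) : IsRelCompl x (insert f L) w' := by
  refine ⟨⟨natLE_trans hj.2.1 hw.1.1, ?_⟩, fun z hz => ?_⟩
  · rintro e (rfl | he)
    exacts [h0, mul_eq_zero_of_natLE hj.2.1 (hw.1.2 e he)]
  · exact natLE_of_isJoin_of_mul_eq_zero hf hj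
      (hw.2 z ⟨hz.1, fun e he => hz.2 e (Set.mem_insert_of_mem _ he)⟩)
      (hz.2 f (Set.mem_insert _ _))

theorem exists_isRelCompl (x : T) {L : Set T} (hL : L.Finite) (hi : ∀ e ∈ L, IsIdempotentElem e) :
    ∃ w, IsRelCompl x L w := by
  induction L, hL using Set.Finite.induction_on with
  | empty => exact ⟨x, isRelCompl_empty x⟩
  | @insert f L _ _ ih =>
    obtain ⟨w, hw⟩ := ih fun e he => hi e (Set.mem_insert_of_mem _ he)
    have hf := hi f (Set.mem_insert _ _)
    obtain ⟨w', h0, hj⟩ := exists_compl w hf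
    exact ⟨w', hw.insert hf h0 hj⟩

end Complements

/-! ### Homomorphisms and relative complements -/

section HomBasics

open InverseSemigroupWithZero

variable {S : Type u} {T : Type v} [InverseSemigroupWithZero S] [InverseSemigroupWithZero T]

theorem Hom.ext {f g : Hom S T} (h : ∀ x, f x = g x) : f = g := by
  obtain ⟨⟨f, _⟩, _⟩ := f
  obtain ⟨⟨g, _⟩, _⟩ := g
  obtain rfl : f = g := funext h
  rfl

theorem Hom.map_mul (f : Hom S T) (x y : S) : f (x * y) = f x * f y := f.map_mul' x y

theorem Hom.map_zero (f : Hom S T) : f 0 = 0 := f.map_zero'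

theorem Hom.map_inv (f : Hom S T) (x : S) : f x⁻¹ = (f x)⁻¹ := by
  apply InverseSemigroupWithZero.inv_unique
  · rw [← f.map_mul, ← f.map_mul, mul_inv_mul]
  · rw [← f.map_mul, ← f.map_mul, inv_mul_inv]

theorem Hom.map_idem (f : Hom S T) {e : S} (he : IsIdempotentElem e) : IsIdempotentElem (f e) := by
  change f e * f e = f e
  rw [← f.map_mul, he.eq]

theorem Hom.map_natLE (f : Hom S T) {a b : S} (h : NatLE a b) : NatLE (f a) (f b) := by
  obtain ⟨e, he, rfl⟩ := h
  exact ⟨f e, f.map_idem he, f.map_mul b e⟩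

/-- An element below `f s` that lies below or is orthogonal to each of finitely many idempotents
in the image of `f` lies below `f r` for a restriction `r` of `s` that reflects this. -/
theorem Hom.exists_restriction (f : Hom S T) {K : Set S} (hK : K.Finite)
    (hi : ∀ e ∈ K, IsIdempotentElem e) {s : S} {z : T} (hz : NatLE z (f s)) :
    ∃ r, NatLE r s ∧ NatLE z (f r) ∧ ∀ e ∈ K, z * f e = z → r * e = r := by
  induction K, hK using Set.Finite.induction_on with
  | empty => exact ⟨s, natLE_refl s, hz, by simp⟩
  | @insert g K _ _ ih =>
    have hg := hi g (Set.mem_insert _ _)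
    obtain ⟨r, hrs, hzr, h⟩ := ih fun e he => hi e (Set.mem_insert_of_mem _ he)
    by_cases hzg : z * f g = z
    -- The witness is `s` multiplied by exactly those idempotents of `K` whose images absorb `z`.
    · refine ⟨r * g, natLE_trans (natLE_mul_idem hg r) hrs, ?_, ?_⟩
      · rw [f.map_mul]; exact natLE_mul_of_mul_eq hzr hzg
      · rintro e (rfl | he) hze
        · exact mul_idem_mul_idem hg r
        · rw [mul_idem_comm hg (hi e (Set.mem_insert_of_mem _ he)), h e he hze]
    · refine ⟨r, hrs, hzr, ?_⟩
      rintro e (rfl | he) hze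
      exacts [absurd hze hzg, h e he hze]

/-- The restriction `r` stays in the cone: if `r * e = r` for some `e ∈ L`, then `f e` would absorb
`z`, whereas `z * f e = 0` and `z ≠ 0`. -/
theorem Hom.exists_mem_cone (f : Hom S T) {K : Set S} (hK : K.Finite)
    (hi : ∀ e ∈ K, IsIdempotentElem e) {s : S} {L : Set S} (hLK : L ⊆ K) {z : T}
    (hz : z ∈ below (f s) (f '' L)) (h0 : z ≠ 0) :
    ∃ r ∈ cone s L, NatLE z (f r) ∧ ∀ e ∈ K, z * f e = z → r * e = r := by
  obtain ⟨r, hrs, hzr, h⟩ := f.exists_restriction hK hi hz.1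
  refine ⟨r, ⟨?_, hrs, fun e he hre => h0 ?_⟩, hzr, h⟩
  · rintro rfl
    rw [f.map_zero] at hzr
    exact h0 (eq_zero_of_natLE hzr)
  · rw [← hz.2 (f e) ⟨e, he, rfl⟩]
    refine (mul_eq_self_of_natLE hzr (f.map_idem (hi e (hLK he))) ?_).symm
    rw [← f.map_mul, hre]

/-- This is the counterpart of `resMul_cone` in the target, with the same conjugated conditions. An
element `z ≤ x * y` is bounded by bounding its factors `z * y⁻¹` and `y * (z⁻¹ * z)` separately. -/
theorem IsRelCompl.mul {x y w w' : T} {L M : Set T} (hw : IsRelCompl x L w)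
    (hw' : IsRelCompl y M w') (hL : ∀ e ∈ L, IsIdempotentElem e) :
    IsRelCompl (x * y) ((fun e => y⁻¹ * e * y) '' L ∪ M) (w * w') := by
  refine ⟨⟨natLE_mul hw.1.1 hw'.1.1, ?_⟩, fun z hz => ?_⟩
  · rintro _ (⟨e, he, rfl⟩ | he)
    · calc w * w' * (y⁻¹ * e * y) = w * (w' * y⁻¹) * e * y := by simp only [mul_assoc]
        _ = (w * e) * (w' * y⁻¹) * y := by
          rw [mul_inv_of_natLE hw'.1.1, mul_idem_comm (idem_mul_inv w') (hL e he)]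
        _ = 0 := by rw [hw.1.2 e he, zero_mul, zero_mul]
    · rw [mul_assoc, hw'.1.2 _ he, mul_zero]
  · rw [← mul_inv_mul_mul_cancel y z hz.1]
    refine natLE_mul (hw.2 _ ⟨mul_inv_natLE hz.1, fun e he => ?_⟩)
      (hw'.2 _ ⟨natLE_mul_idem (idem_inv_mul z) y, fun e he => ?_⟩)
    · calc z * y⁻¹ * e = z * (y⁻¹ * y * y⁻¹) * e := by rw [inv_mul_inv]
        _ = z * y⁻¹ * (y * y⁻¹) * e := by simp only [mul_assoc]
        _ = z * y⁻¹ * e * (y * y⁻¹) := mul_idem_comm (idem_mul_inv y) (hL e he) _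
        _ = z * (y⁻¹ * e * y) * y⁻¹ := by simp only [mul_assoc]
        _ = 0 := by rw [hz.2 _ (Or.inl ⟨e, he, rfl⟩), zero_mul]
    · rw [mul_assoc, mul_assoc, hz.2 e (Or.inr he), mul_zero, mul_zero]

theorem IsRelCompl.inv {x w : T} {L : Set T} (hw : IsRelCompl x L w)
    (hL : ∀ e ∈ L, IsIdempotentElem e) :
    IsRelCompl x⁻¹ ((fun e => x * e * x⁻¹) '' L) w⁻¹ := by
  refine ⟨⟨natLE_inv hw.1.1, ?_⟩, fun z hz => ?_⟩
  · rintro _ ⟨e, he, rfl⟩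
    rw [inv_mul_conj (hL e he) hw.1.1, hw.1.2 e he, inv_zero_eq]
  · have hzx : NatLE z⁻¹ x := by simpa only [inv_inv_eq] using natLE_inv hz.1
    rw [← inv_inv_eq z]
    refine natLE_inv (hw.2 _ ⟨hzx, fun e he => ?_⟩)
    rw [← inv_eq_zero_iff, ← inv_mul_conj (hL e he) hzx, inv_inv_eq]
    exact hz.2 _ ⟨e, he, rfl⟩

end HomBasics

/-! ### The universal property -/

section Extension

open InverseSemigroupWithZero DistributiveInverseSemigroup

variable {S : Type u} {T : Type v} [InverseSemigroupWithZero S] [BooleanInverseSemigroup T]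

/-- `w` is the element of `T` that corresponds to the cone `Y`. -/
def IsPiece (θ : Hom S T) (Y : Set S) (w : T) : Prop :=
  ∃ (s : S) (L : Set S), L.Finite ∧ (∀ e ∈ L, IsIdempotentElem e) ∧ Y = cone s L ∧
    IsRelCompl (θ s) (θ '' L) w

/-- The elements of `T` below a piece that corresponds to a cone inside `X`. -/
def pieces (θ : Hom S T) (X : Set S) : Set T :=
  {z | ∃ (s : S) (L : Set S), L.Finite ∧ (∀ e ∈ L, IsIdempotentElem e) ∧ cone s L ⊆ X ∧
    z ∈ below (θ s) (θ '' L)}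

theorem IsCone.exists_isPiece (θ : Hom S T) {Y : Set S} (hY : IsCone Y) :
    ∃ w, IsPiece θ Y w := by
  obtain ⟨s, L, hL, hi, rfl⟩ := hY
  obtain ⟨w, hw⟩ := exists_isRelCompl (θ s) (hL.image θ)
    (by rintro _ ⟨e, he, rfl⟩; exact θ.map_idem (hi e he))
  exact ⟨w, s, L, hL, hi, rfl, hw⟩

theorem IsPiece.mem_pieces {θ : Hom S T} {X Y : Set S} {w : T} (h : IsPiece θ Y w)
    (hYX : Y ⊆ X) : w ∈ pieces θ X := by
  obtain ⟨s, L, hL, hi, rfl, hw⟩ := h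
  exact ⟨s, L, hL, hi, hYX, hw.1⟩

theorem IsPiece.mul {θ : Hom S T} {Y Y' : Set S} {w w' : T} (h : IsPiece θ Y w)
    (h' : IsPiece θ Y' w') : IsPiece θ (resMul Y Y') (w * w') := by
  obtain ⟨s, L, hL, hi, rfl, hw⟩ := h
  obtain ⟨t, M, hM, hj, rfl, hw'⟩ := h'
  refine ⟨s * t, _, (hL.image _).union hM, ?_, resMul_cone s t L M hi, ?_⟩
  · rintro _ (⟨e, he, rfl⟩ | he)
    exacts [idem_conj' t (hi e he), hj _ he]
  · have := hw.mul hw' (by rintro _ ⟨e, he, rfl⟩; exact θ.map_idem (hi e he))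
    rw [θ.map_mul, Set.image_union, Set.image_image]
    rw [Set.image_image] at this
    simpa only [θ.map_mul, θ.map_inv] using this

theorem IsPiece.inv {θ : Hom S T} {Y : Set S} {w : T} (h : IsPiece θ Y w) :
    IsPiece θ Y⁻¹ w⁻¹ := by
  obtain ⟨s, L, hL, hi, rfl, hw⟩ := h
  refine ⟨s⁻¹, _, hL.image _, ?_, inv_cone s L hi, ?_⟩
  · rintro _ ⟨e, he, rfl⟩
    exact idem_conj s (hi e he)
  · have := hw.inv (by rintro _ ⟨e, he, rfl⟩; exact θ.map_idem (hi e he))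
    rw [θ.map_inv, Set.image_image]
    rw [Set.image_image] at this
    simpa only [θ.map_mul, θ.map_inv] using this

/-- A nonzero `w` lies below `θ r` for some `r` in the cone, and `r` is idempotent. -/
theorem IsPiece.idem {θ : Hom S T} {Y : Set S} {w : T} (h : IsPiece θ Y w)
    (hY : ∀ y ∈ Y, IsIdempotentElem y) : IsIdempotentElem w := by
  obtain ⟨s, L, hL, hi, rfl, hw⟩ := h
  have hi' : ∀ e ∈ θ '' L, IsIdempotentElem e := by
    rintro _ ⟨e, he, rfl⟩; exact θ.map_idem (hi e he)
  refine idem_of_natLE (e := w * w⁻¹) ?_ (idem_mul_inv w)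
  by_cases h0 : w = 0
  · rw [h0]; exact zero_natLE _
  obtain ⟨r, hr, hwr, -⟩ := θ.exists_mem_cone hL hi subset_rfl hw.1 h0
  have := idem_of_natLE hwr (θ.map_idem (hY r hr))
  rw [idem_inv this, this.eq]
  exact natLE_refl w

/-- The products `w⁻¹ * w'` and `w * w'⁻¹` are pieces of the corresponding products of cones, which
consist of idempotents since both cones lie in one bisection. -/
theorem IsPiece.compatible {θ : Hom S T} {X Y Y' : Set S} {w w' : T} (hX : IsBisection X)
    (hY : Y ⊆ X) (hY' : Y' ⊆ X) (h : IsPiece θ Y w) (h' : IsPiece θ Y' w') :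
    Compatible w w' :=
  ⟨(h.inv.mul h').idem fun _ hp => hX.idem_inv_resMul (resMul_mono (inv_subset_inv hY) hY' hp),
    (h.mul h'.inv).idem fun _ hp => hX.idem_resMul_inv (resMul_mono hY (inv_subset_inv hY') hp)⟩

/-- An element associated with a cone that is covered by finitely many cones is bounded by the
pieces associated with the latter. -/
theorem natLE_of_mem_pieces {θ : Hom S T} {F : Set (Set S)} (hF : F.Finite) {y z : T}
    (hy : ∀ Y ∈ F, ∃ w, IsPiece θ Y w ∧ NatLE w y) (hz : z ∈ pieces θ (⋃₀ F)) : NatLE z y := by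
  obtain ⟨s, L, hL, hi, hsub, hz⟩ := hz
  choose! w hp hwy using hy
  choose! t M hM hj hYt hw using hp
  -- These are all conditions of the given cone and of the covering cones. Splitting along their
  -- images reduces the claim to parts `z'` that each image absorbs or annihilates.
  have hK : (L ∪ ⋃ Y ∈ F, M Y).Finite := hL.union (hF.biUnion hM)
  have hKi : ∀ e ∈ L ∪ ⋃ Y ∈ F, M Y, IsIdempotentElem e := by
    rintro e (he | he)
    · exact hi e he
    · obtain ⟨Y, hY, he⟩ := Set.mem_iUnion₂.1 he
      exact hj Y hY e he
  refine natLE_of_forall_split (hK.image θ)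
    (by rintro _ ⟨e, he, rfl⟩; exact θ.map_idem (hKi e he)) fun z' hz' hgen => ?_
  by_cases h0 : z' = 0
  · rw [h0]; exact zero_natLE y
  -- The part `z'` leads to a point `r` of the given cone, and the covering cone `Y` through `r` has
  -- its piece above `z'`.
  obtain ⟨r, hr, hzr, h⟩ := θ.exists_mem_cone hK hKi Set.subset_union_left
    (⟨natLE_trans hz' hz.1, fun e he => mul_eq_zero_of_natLE hz' (hz.2 e he)⟩ :
      z' ∈ below (θ s) (θ '' L)) h0
  obtain ⟨Y, hY, hrY⟩ := hsub hr
  refine natLE_trans ((hw Y hY).2 z' ⟨?_, ?_⟩) (hwy Y hY)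
  · rw [hYt Y hY] at hrY
    exact natLE_trans hzr (θ.map_natLE hrY.2.1)
  · rintro _ ⟨e, he, rfl⟩
    have heK : e ∈ L ∪ ⋃ Y ∈ F, M Y := Or.inr (Set.mem_biUnion hY he)
    rw [hYt Y hY] at hrY
    -- If `θ e` absorbed `z'`, then `e` would absorb `r`, contrary to `r ∈ Y`.
    exact (hgen (θ e) ⟨e, heK, rfl⟩).resolve_left fun h1 => hrY.2.2 e he (h e heK h1)

/-- `W` is the set of pieces that correspond to a finite decomposition of `X` into cones. -/
structure Decomposes (θ : Hom S T) (X : Set S) (W : Set T) : Prop where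
  finite : W.Finite
  isPiece : ∀ w ∈ W, ∃ Y ⊆ X, IsPiece θ Y w
  cover : ∃ F : Set (Set S), F.Finite ∧ X = ⋃₀ F ∧ ∀ Y ∈ F, ∃ w ∈ W, IsPiece θ Y w

theorem Constructible.exists_decomposes (θ : Hom S T) {X : Set S} (hX : Constructible X) :
    ∃ W, Decomposes θ X W := by
  obtain ⟨F, hF, hFc, rfl⟩ := hX
  choose! w hw using fun Y hY => (hFc Y hY).exists_isPiece θ
  refine ⟨w '' F, hF.image w, ?_, F, hF, rfl, fun Y hY => ⟨w Y, ⟨Y, hY, rfl⟩, hw Y hY⟩⟩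
  rintro _ ⟨Y, hY, rfl⟩
  exact ⟨Y, Set.subset_sUnion_of_mem hY, hw Y hY⟩

theorem Decomposes.compatible {θ : Hom S T} {X : Set S} {W : Set T} (h : Decomposes θ X W)
    (hX : IsBisection X) : ∀ a ∈ W, ∀ b ∈ W, Compatible a b := by
  intro a ha b hb
  obtain ⟨Y, hY, hpa⟩ := h.isPiece a ha
  obtain ⟨Z, hZ, hpb⟩ := h.isPiece b hb
  exact hpa.compatible hX hY hZ hpb

/-- The set `pieces θ X` refers to no decomposition, so the supremum of `W` depends on `X` alone. -/
theorem Decomposes.isSup {θ : Hom S T} {X : Set S} {W : Set T} (h : Decomposes θ X W) {y : T}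
    (hy : IsSup W y) : IsSup (pieces θ X) y := by
  constructor
  · obtain ⟨F, hF, rfl, hFW⟩ := h.cover
    intro z hz
    refine natLE_of_mem_pieces hF (fun Y hY => ?_) hz
    obtain ⟨w, hw, hp⟩ := hFW Y hY
    exact ⟨w, hp, hy.1 w hw⟩
  · intro d hd
    refine hy.2 d fun w hw => ?_
    obtain ⟨Y, hY, hp⟩ := h.isPiece w hw
    exact hd w (hp.mem_pieces hY)

theorem Decomposes.mul {θ : Hom S T} {X X' : Set S} {W W' : Set T} (h : Decomposes θ X W)
    (h' : Decomposes θ X' W') : Decomposes θ (resMul X X') (Set.image2 (· * ·) W W') := by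
  refine ⟨h.finite.image2 _ h'.finite, ?_, ?_⟩
  · rintro _ ⟨w, hw, w', hw', rfl⟩
    obtain ⟨Y, hY, hp⟩ := h.isPiece w hw
    obtain ⟨Y', hY', hp'⟩ := h'.isPiece w' hw'
    exact ⟨resMul Y Y', resMul_mono hY hY', hp.mul hp'⟩
  · obtain ⟨F, hF, rfl, hFW⟩ := h.cover
    obtain ⟨F', hF', rfl, hFW'⟩ := h'.cover
    refine ⟨_, hF.image2 _ hF', resMul_sUnion F F', ?_⟩
    rintro _ ⟨Y, hY, Y', hY', rfl⟩
    obtain ⟨w, hw, hp⟩ := hFW Y hY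
    obtain ⟨w', hw', hp'⟩ := hFW' Y' hY'
    exact ⟨w * w', ⟨w, hw, w', hw', rfl⟩, hp.mul hp'⟩

theorem Decomposes.union {θ : Hom S T} {X X' : Set S} {W W' : Set T} (h : Decomposes θ X W)
    (h' : Decomposes θ X' W') : Decomposes θ (X ∪ X') (W ∪ W') := by
  refine ⟨h.finite.union h'.finite, ?_, ?_⟩
  · rintro w (hw | hw)
    · obtain ⟨Y, hY, hp⟩ := h.isPiece w hw
      exact ⟨Y, hY.trans Set.subset_union_left, hp⟩
    · obtain ⟨Y, hY, hp⟩ := h'.isPiece w hw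
      exact ⟨Y, hY.trans Set.subset_union_right, hp⟩
  · obtain ⟨F, hF, rfl, hFW⟩ := h.cover
    obtain ⟨F', hF', rfl, hFW'⟩ := h'.cover
    refine ⟨F ∪ F', hF.union hF', (Set.sUnion_union F F').symm, ?_⟩
    rintro Y (hY | hY)
    · obtain ⟨w, hw, hp⟩ := hFW Y hY
      exact ⟨w, Or.inl hw, hp⟩
    · obtain ⟨w, hw, hp⟩ := hFW' Y hY
      exact ⟨w, Or.inr hw, hp⟩

theorem decomposes_empty (θ : Hom S T) : Decomposes θ ∅ ∅ :=
  ⟨Set.finite_empty, by simp, ∅, Set.finite_empty, by simp, by simp⟩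

theorem decomposes_of (θ : Hom S T) (s : S) : Decomposes θ (cone s ∅) {θ s} := by
  have hp : IsPiece θ (cone s ∅) (θ s) :=
    ⟨s, ∅, Set.finite_empty, by simp, rfl, by rw [Set.image_empty]; exact isRelCompl_empty _⟩
  refine ⟨Set.finite_singleton _, ?_, {cone s ∅}, Set.finite_singleton _,
    (Set.sUnion_singleton _).symm, ?_⟩
  · rintro _ rfl
    exact ⟨_, subset_rfl, hp⟩
  · rintro _ rfl
    exact ⟨_, rfl, hp⟩

theorem Bis.exists_isSup_pieces (θ : Hom S T) (X : Bis S) : ∃ y, IsSup (pieces θ X.1) y := by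
  obtain ⟨W, hW⟩ := X.2.1.exists_decomposes θ
  obtain ⟨y, hy, -⟩ := exists_isSup hW.finite (hW.compatible X.2.2)
  exact ⟨y, hW.isSup hy⟩

/-- The extension of a homomorphism to the Booleanization. -/
noncomputable def Bis.liftFun (θ : Hom S T) (X : Bis S) : T := (exists_isSup_pieces θ X).choose

/-- Any decomposition computes the extension. Products and joins can thus be treated with
decompositions adapted to them. -/
theorem Bis.isSup_liftFun {θ : Hom S T} {X : Bis S} {W : Set T} (h : Decomposes θ X.1 W) :
    IsSup W (liftFun θ X) := by
  obtain ⟨y, hy, -⟩ := exists_isSup h.finite (h.compatible X.2.2)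
  rw [liftFun, (exists_isSup_pieces θ X).choose_spec.unique (h.isSup hy)]
  exact hy

/-- The extension of a homomorphism to the Booleanization, as a morphism. -/
noncomputable def Bis.lift (θ : Hom S T) : Morphism (Bis S) T where
  toFun := liftFun θ
  map_mul' X Y := by
    obtain ⟨W, hW⟩ := X.2.1.exists_decomposes θ
    obtain ⟨W', hW'⟩ := Y.2.1.exists_decomposes θ
    exact (isSup_liftFun (X := X * Y) (hW.mul hW')).unique
      ((isSup_liftFun hW).mul hW.finite (hW.compatible X.2.2) hW'.finite
        (hW'.compatible Y.2.2) (isSup_liftFun hW'))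
  map_zero' := (isSup_liftFun (X := 0) (decomposes_empty θ)).unique isSup_empty
  map_join' X Y Z h hj := by
    obtain ⟨W, hW⟩ := X.2.1.exists_decomposes θ
    obtain ⟨W', hW'⟩ := Y.2.1.exists_decomposes θ
    have hU := hW.union hW'
    rw [← (isJoin_iff h).1 hj] at hU
    have h1 := isSup_liftFun hW
    have h2 := isSup_liftFun hW'
    have h3 := isSup_liftFun hU
    refine ⟨h1.2 _ fun w hw => h3.1 w (Or.inl hw), h2.2 _ fun w hw => h3.1 w (Or.inr hw),
      fun d hd hd' => h3.2 d ?_⟩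
    rintro w (hw | hw)
    exacts [natLE_trans (h1.1 w hw) hd, natLE_trans (h2.1 w hw) hd']

theorem Bis.lift_beta (θ : Hom S T) (s : S) : (lift θ).toHom (beta S s) = θ s := by
  refine (isSup_liftFun (X := of s) (decomposes_of θ s)).unique ⟨?_, fun d hd => hd _ rfl⟩
  rintro _ rfl
  exact natLE_refl _

/-- An idempotent `q ≤ e` is composable with `r` only if `q = r⁻¹ * r`, and then `r * q = r`. -/
theorem resMul_cone_idem (X : Set S) {e : S} (h0 : (0 : S) ∉ X) (he : IsIdempotentElem e) :
    resMul X (cone e ∅) = {r ∈ X | r * e = r} := by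
  ext p
  constructor
  · rintro ⟨r, hr, q, hq, h, rfl⟩
    have hq := (mem_cone_empty.1 hq).2
    have hqi := idem_of_natLE hq he
    rw [idem_inv hqi, hqi.eq] at h
    have hrq : r * q = r := by rw [← h, ← mul_assoc, mul_inv_mul]
    rw [hrq]
    refine ⟨hr, ?_⟩
    rw [← hrq, mul_assoc, mul_eq_self_of_natLE hq he he.eq]
  · rintro ⟨hp, hpe⟩
    refine ⟨p, hp, p⁻¹ * p, mem_cone_empty.2 ⟨fun h => h0 ?_, p⁻¹ * p, idem_inv_mul p, ?_⟩, ?_,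
      by rw [← mul_assoc, mul_inv_mul]⟩
    · rwa [← mul_inv_mul p, mul_assoc, h, mul_zero] at hp
    · rw [idem_comm he (idem_inv_mul p), mul_assoc, hpe]
    · rw [idem_inv (idem_inv_mul p), (idem_inv_mul p).eq]

/-- A cone, as an element of the Booleanization. -/
def Bis.ofCone (s : S) (L : Set S) (hL : L.Finite) (hi : ∀ e ∈ L, IsIdempotentElem e) : Bis S :=
  ⟨cone s L, constructible_cone hL hi, isBisection_cone s L⟩

/-- Adding a condition `f` to `L` splits the cone into the part absorbed by `f` and the smaller
cone, which is annihilated by `f`. A morphism preserves this join and this zero product, so its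
values on cones are forced by those on the image of `Bis.beta`. -/
theorem Morphism.isRelCompl_ofCone (γ : Morphism (Bis S) T) (s : S) {L : Set S} (hL : L.Finite)
    (hi : ∀ e ∈ L, IsIdempotentElem e) :
    IsRelCompl (γ.toHom (Bis.beta S s)) ((fun e => γ.toHom (Bis.beta S e)) '' L)
      (γ.toHom (Bis.ofCone s L hL hi)) := by
  induction L, hL using Set.Finite.induction_on with
  | empty => rw [Set.image_empty]; exact isRelCompl_empty _
  | @insert f L _ hL ih =>
    have hf := hi f (Set.mem_insert _ _)
    have hi' := fun e he => hi e (Set.mem_insert_of_mem f he)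
    rw [Set.image_insert_eq]
    have hC := resMul_cone_idem (cone s L) (fun h => h.1 rfl) hf
    have hU : (Bis.ofCone s L hL hi').1 =
        (Bis.ofCone s L hL hi' * Bis.of f).1 ∪ (Bis.ofCone s _ (hL.insert f) hi).1 := by
      change cone s L = resMul (cone s L) (cone f ∅) ∪ cone s (insert f L)
      rw [hC]
      ext r
      constructor
      · intro hr
        by_cases h : r * f = r
        · exact Or.inl ⟨hr, h⟩
        · refine Or.inr ⟨hr.1, hr.2.1, ?_⟩
          rintro e (rfl | he)
          exacts [h, hr.2.2 e he]
      · rintro (hr | hr)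
        exacts [hr.1, cone_subset_of_subset (Set.subset_insert f L) hr]
    have h0 : Bis.ofCone s _ (hL.insert f) hi * Bis.of f = 0 := by
      apply Subtype.ext
      change resMul (cone s (insert f L)) (cone f ∅) = ∅
      rw [resMul_cone_idem _ (fun h => h.1 rfl) hf, Set.eq_empty_iff_forall_notMem]
      exact fun r hr => hr.1.2.2 f (Set.mem_insert _ _) hr.2
    have hc : Compatible (Bis.ofCone s L hL hi' * Bis.of f)
        (Bis.ofCone s _ (hL.insert f) hi) := by
      apply Bis.compatible_of_isBisection_union
      rw [← hU]
      exact isBisection_cone s L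
    refine (ih hi').insert (γ.toHom.map_idem ((Bis.beta S).map_idem hf)) ?_ ?_
    · rw [← γ.toHom.map_mul, show Bis.beta S f = Bis.of f from rfl, h0, γ.toHom.map_zero]
    · rw [← γ.toHom.map_mul]
      exact γ.map_join' _ _ _ hc (Bis.isJoin_of_val_eq hU)

theorem Bis.morphism_ext {γ γ' : Morphism (Bis S) T}
    (h : ∀ s, γ.toHom (beta S s) = γ'.toHom (beta S s)) : γ = γ' := by
  have key : ∀ (X : Set S) (hX : Constructible X) (hb : IsBisection X),
      γ.toHom ⟨X, hX, hb⟩ = γ'.toHom ⟨X, hX, hb⟩ := by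
    intro X hX
    induction hX using Constructible.induction with
    | empty => exact fun _ => γ.toHom.map_zero.trans γ'.toHom.map_zero.symm
    | cone_union s L Y hL hi hY ih hU =>
      intro hb
      have hYb := hb.mono Set.subset_union_right
      have hc : Compatible (ofCone s L hL hi) ⟨Y, hY, hYb⟩ := compatible_of_isBisection_union hb
      have hj : IsJoin (ofCone s L hL hi) ⟨Y, hY, hYb⟩ ⟨_, hU, hb⟩ := isJoin_of_val_eq rfl
      have h1 := γ.map_join' _ _ _ hc hj
      have h2 := γ'.map_join' _ _ _ hc hj
      have h3 := γ.isRelCompl_ofCone s hL hi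
      simp only [h] at h3
      have h4 := h3.unique (γ'.isRelCompl_ofCone s hL hi)
      refine h1.unique ?_
      have h5 := ih hYb
      change γ.toFun _ = γ'.toFun _ at h4 h5
      rw [h4, h5]
      exact h2
  obtain ⟨g, hg⟩ := γ
  obtain ⟨g', hg'⟩ := γ'
  obtain rfl : g = g' := Hom.ext fun X => key X.1 X.2.1 X.2.2
  rfl

theorem Bis.existsUnique_lift (θ : Hom S T) :
    ∃! γ : Morphism (Bis S) T, γ.toHom.comp (beta S) = θ := by
  refine ⟨lift θ, Hom.ext (lift_beta θ), fun γ hγ => morphism_ext fun s => ?_⟩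
  rw [lift_beta θ s, ← hγ]
  rfl

end Extension

/-! ### Order and joins in the distributive completion -/

section Completion

variable {S : Type u} [InverseSemigroupWithZero S]

open InverseSemigroupWithZero

theorem DistCompletion.natLE_iff {A B : DistCompletion S} : NatLE A B ↔ A.1 ⊆ B.1 := by
  constructor
  · rintro ⟨E, hE, rfl⟩ _ ⟨b, hb, e, he, rfl⟩
    exact B.lower hb (natLE_mul_idem (E.idem_subset hE.eq he) b)
  · intro h
    refine ⟨A⁻¹ * A, idem_inv_mul A, Subtype.ext ?_⟩
    ext a
    constructor
    · intro ha
      refine ⟨a, h ha, a⁻¹ * a, ⟨a⁻¹, inv_mem_inv.2 ha, a, ha, rfl⟩, ?_⟩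
      change a * (a⁻¹ * a) = a
      rw [← mul_assoc, mul_inv_mul]
    · rintro ⟨b, hb, _, ⟨c, hc, d, hd, rfl⟩, rfl⟩
      refine A.lower hd ?_
      change NatLE (b * (c * d)) d
      rw [← mul_assoc]
      have := (B.compat hb (h hc)).2
      rw [inv_inv_eq] at this
      exact natLE_idem_mul this d

theorem down_subset_iff {F : Set S} {A : DistCompletion S} : down F ⊆ A.1 ↔ F ⊆ A.1 :=
  ⟨fun h a ha => h ⟨a, ha, natLE_refl a⟩, fun h _ ⟨_, hx, hsx⟩ => A.lower (h hx) hsx⟩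

theorem principal_natLE_iff {s : S} {A : DistCompletion S} : NatLE (principal s) A ↔ s ∈ A.1 := by
  rw [DistCompletion.natLE_iff]
  exact down_subset_iff.trans Set.singleton_subset_iff

theorem mem_principal {s t : S} : t ∈ (principal s).1 ↔ NatLE t s := by
  simp [principal, down]

theorem principal_mul (s t : S) : principal s * principal t = principal (s * t) := by
  apply Subtype.ext
  change down {s} * down {t} = down {s * t}
  rw [down_mul, Set.singleton_mul_singleton]

theorem principal_zero : principal (0 : S) = 0 := by
  apply Subtype.ext
  ext t
  rw [mem_principal, DistCompletion.zero_val]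
  exact ⟨eq_zero_of_natLE, fun h => natLE_of_eq h⟩

/-- The order ideal that is generated by a finite nonempty compatible set. -/
def DistCompletion.gen (F : Set S) (hF : F.Finite) (h0 : F.Nonempty)
    (hc : ∀ a ∈ F, ∀ b ∈ F, Compatible a b) : DistCompletion S := ⟨down F, F, hF, h0, hc, rfl⟩

theorem DistCompletion.compatible_of_mem {A B : DistCompletion S} (h : Compatible A B) {a b : S}
    (ha : a ∈ A.1) (hb : b ∈ B.1) : Compatible a b :=
  ⟨(A⁻¹ * B).idem_subset h.1.eq ⟨a⁻¹, inv_mem_inv.2 ha, b, hb, rfl⟩,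
    (A * B⁻¹).idem_subset h.2.eq ⟨a, ha, b⁻¹, inv_mem_inv.2 hb, rfl⟩⟩

theorem DistCompletion.isJoin_of_val_eq {A B C : DistCompletion S} (h : C.1 = A.1 ∪ B.1) :
    IsJoin A B C := by
  refine ⟨natLE_iff.2 ?_, natLE_iff.2 ?_, fun D hA hB => natLE_iff.2 ?_⟩
  · rw [h]; exact Set.subset_union_left
  · rw [h]; exact Set.subset_union_right
  · rw [h]; exact Set.union_subset (natLE_iff.1 hA) (natLE_iff.1 hB)

theorem down_union (F G : Set S) : down (F ∪ G) = down F ∪ down G := by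
  ext s
  constructor
  · rintro ⟨x, hx | hx, h⟩
    exacts [Or.inl ⟨x, hx, h⟩, Or.inr ⟨x, hx, h⟩]
  · rintro (⟨x, hx, h⟩ | ⟨x, hx, h⟩)
    exacts [⟨x, Or.inl hx, h⟩, ⟨x, Or.inr hx, h⟩]

/-- The generators of two compatible ideals are compatible with each other, so the union of the
ideals is again in the completion. -/
theorem DistCompletion.val_eq_of_isJoin {A B C : DistCompletion S} (hc : Compatible A B)
    (h : IsJoin A B C) : C.1 = A.1 ∪ B.1 := by
  have hex : ∃ J : DistCompletion S, J.1 = A.1 ∪ B.1 := by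
    obtain ⟨F, hF, hF0, hFc, hA⟩ := A.2
    obtain ⟨G, hG, hG0, hGc, hB⟩ := B.2
    have hFA : F ⊆ A.1 := down_subset_iff.1 hA.ge
    have hGB : G ⊆ B.1 := down_subset_iff.1 hB.ge
    refine ⟨gen (F ∪ G) (hF.union hG) hF0.inl ?_, ?_⟩
    · rintro a (ha | ha) b (hb | hb)
      exacts [hFc a ha b hb, compatible_of_mem hc (hFA ha) (hGB hb),
        (compatible_of_mem hc (hFA hb) (hGB ha)).symm, hGc a ha b hb]
    · rw [hA, hB]
      exact down_union F G
  obtain ⟨J, hJ⟩ := hex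
  rw [h.unique (isJoin_of_val_eq hJ), hJ]

end Completion

/-! ### Prime filters of the completion as proper filters of the semigroup -/

section Filters

variable {S : Type u} [InverseSemigroupWithZero S]

open InverseSemigroupWithZero

/-- Proper filters. -/
structure IsProperFilter (F : Set S) : Prop where
  nonempty : F.Nonempty
  mem_of_natLE : ∀ a ∈ F, ∀ b, NatLE a b → b ∈ F
  directed : ∀ a ∈ F, ∀ b ∈ F, ∃ c ∈ F, NatLE c a ∧ NatLE c b
  zero_notMem : (0 : S) ∉ F

/-- The prime filter of the distributive completion that is associated with a proper filter. -/
def extend (F : Set S) : Set (DistCompletion S) := {A | ∃ a ∈ A.1, a ∈ F}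

theorem principal_mem_extend {F : Set S} (h : ∀ a ∈ F, ∀ b, NatLE a b → b ∈ F) {s : S} :
    principal s ∈ extend F ↔ s ∈ F :=
  ⟨fun ⟨a, ha, haF⟩ => h a haF s (mem_principal.1 ha),
    fun hs => ⟨s, mem_principal.2 (natLE_refl s), hs⟩⟩

theorem mem_up_of_natLE (F : Set S) : ∀ a ∈ up F, ∀ b, NatLE a b → b ∈ up F :=
  fun _ ⟨x, hx, hxa⟩ _ hab => ⟨x, hx, natLE_trans hxa hab⟩

theorem extend_inj {F G : Set S} (hF : ∀ a ∈ F, ∀ b, NatLE a b → b ∈ F)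
    (hG : ∀ a ∈ G, ∀ b, NatLE a b → b ∈ G) : extend F = extend G ↔ F = G := by
  refine ⟨fun h => ?_, fun h => by rw [h]⟩
  ext s
  rw [← principal_mem_extend hF, h, principal_mem_extend hG]

/-- Primality costs nothing: an element of a compatible join lies in one of the two ideals. -/
theorem IsProperFilter.isPrimeFilter {F : Set S} (hF : IsProperFilter F) :
    IsPrimeFilter (extend F) where
  nonempty := by
    obtain ⟨s, hs⟩ := hF.nonempty
    exact ⟨principal s, (principal_mem_extend hF.mem_of_natLE).2 hs⟩
  up_closed := by
    ext A
    constructor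
    · rintro ⟨B, ⟨b, hb, hbF⟩, hBA⟩
      exact ⟨b, DistCompletion.natLE_iff.1 hBA hb, hbF⟩
    · exact fun hA => ⟨A, hA, natLE_refl A⟩
  directed := by
    rintro A ⟨a, ha, haF⟩ B ⟨b, hb, hbF⟩
    obtain ⟨c, hc, hca, hcb⟩ := hF.directed a haF b hbF
    exact ⟨principal c, (principal_mem_extend hF.mem_of_natLE).2 hc,
      principal_natLE_iff.2 (A.lower ha hca), principal_natLE_iff.2 (B.lower hb hcb)⟩
  proper := by
    rw [← principal_zero, principal_mem_extend hF.mem_of_natLE]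
    exact hF.zero_notMem
  prime := by
    rintro A B C hc hj ⟨c, hcC, hcF⟩
    rw [DistCompletion.val_eq_of_isJoin hc hj] at hcC
    exact hcC.imp (fun h => ⟨c, h, hcF⟩) (fun h => ⟨c, h, hcF⟩)

theorem IsPrimeFilter.mem_of_natLE {P : Set S} (hP : IsPrimeFilter P) {a b : S}
    (ha : a ∈ P) (h : NatLE a b) : b ∈ P := by
  rw [← hP.up_closed]; exact ⟨a, ha, h⟩

/-- An ideal in the completion is the join of the principal ideals of its finitely many generators,
and primality selects one of them. -/
theorem IsPrimeFilter.exists_principal_mem {P : Set (DistCompletion S)} (hP : IsPrimeFilter P)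
    {A : DistCompletion S} (hA : A ∈ P) : ∃ a ∈ A.1, principal a ∈ P := by
  have key : ∀ (G : Set S), G.Finite → G.Nonempty → (∀ a ∈ G, ∀ b ∈ G, Compatible a b) →
      ∀ B ∈ P, B.1 = down G → ∃ a ∈ G, principal a ∈ P := by
    intro G hG
    induction G, hG using Set.Finite.induction_on with
    | empty => exact fun h => (Set.not_nonempty_empty h).elim
    | @insert g G _ hG ih =>
      intro _ hc B hB hBG
      have hc' : ∀ a ∈ G, ∀ b ∈ G, Compatible a b := fun a ha b hb =>
        hc a (Set.mem_insert_of_mem _ ha) b (Set.mem_insert_of_mem _ hb)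
      -- The completion has no empty ideal, so the induction really starts at singletons.
      rcases G.eq_empty_or_nonempty with rfl | h0
      · refine ⟨g, Set.mem_insert _ _, ?_⟩
        rwa [← show B = principal g from Subtype.ext (by rw [hBG, insert_empty_eq]; rfl)]
      · have hu : B.1 = (principal g).1 ∪ (DistCompletion.gen G hG h0 hc').1 := by
          rw [hBG, Set.insert_eq, down_union]; rfl
        have hj := DistCompletion.isJoin_of_val_eq hu
        rcases hP.prime _ _ _ (compatible_of_common_bound hj.1 hj.2.1) hj hB with h | h
        · exact ⟨g, Set.mem_insert _ _, h⟩
        · obtain ⟨a, ha, haP⟩ := ih h0 hc' _ h rfl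
          exact ⟨a, Set.mem_insert_of_mem _ ha, haP⟩
  obtain ⟨G, hG, h0, hc, hAG⟩ := A.2
  obtain ⟨a, ha, haP⟩ := key G hG h0 hc A hA hAG
  exact ⟨a, down_subset_iff.1 hAG.ge ha, haP⟩

/-- The proper filter that belongs to `P` consists of the `s` with `principal s ∈ P`. -/
theorem isPrimeFilter_iff {P : Set (DistCompletion S)} :
    IsPrimeFilter P ↔ ∃ F, IsProperFilter F ∧ P = extend F := by
  refine ⟨fun hP => ⟨{s | principal s ∈ P}, ⟨?_, ?_, ?_, ?_⟩, ?_⟩, ?_⟩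
  · obtain ⟨A, hA⟩ := hP.nonempty
    obtain ⟨a, -, ha⟩ := hP.exists_principal_mem hA
    exact ⟨a, ha⟩
  · exact fun a ha b hab =>
      hP.mem_of_natLE ha (principal_natLE_iff.2 (mem_principal.2 hab))
  · intro a ha b hb
    obtain ⟨C, hC, hCa, hCb⟩ := hP.directed _ ha _ hb
    obtain ⟨c, hcC, hc⟩ := hP.exists_principal_mem hC
    exact ⟨c, hc, mem_principal.1 (DistCompletion.natLE_iff.1 hCa hcC),
      mem_principal.1 (DistCompletion.natLE_iff.1 hCb hcC)⟩
  · intro h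
    rw [Set.mem_ofPred_eq, principal_zero] at h
    exact hP.proper h
  · ext A
    exact ⟨hP.exists_principal_mem, fun ⟨a, ha, haP⟩ =>
      hP.mem_of_natLE haP (principal_natLE_iff.2 ha)⟩
  · rintro ⟨F, hF, rfl⟩
    exact hF.isPrimeFilter

theorem extend_up_mul (F G : Set S) : up (extend F * extend G) = extend (up (F * G)) := by
  ext A
  constructor
  · rintro ⟨_, ⟨B, ⟨b, hb, hbF⟩, C, ⟨c, hc, hcG⟩, rfl⟩, h⟩
    exact ⟨b * c, DistCompletion.natLE_iff.1 h ⟨b, hb, c, hc, rfl⟩, b * c,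
      ⟨b, hbF, c, hcG, rfl⟩, natLE_refl _⟩
  · rintro ⟨a, ha, _, ⟨f, hf, g, hg, rfl⟩, h⟩
    refine ⟨_, ⟨principal f, ⟨f, mem_principal.2 (natLE_refl f), hf⟩, principal g,
      ⟨g, mem_principal.2 (natLE_refl g), hg⟩, rfl⟩, ?_⟩
    change NatLE (principal f * principal g) A
    rw [principal_mul, principal_natLE_iff]
    exact A.lower ha h

theorem extend_inv (F : Set S) : (extend F)⁻¹ = extend F⁻¹ := by
  ext A
  constructor
  · rintro ⟨a, ha, haF⟩
    exact ⟨a⁻¹, ha, inv_mem_inv.2 haF⟩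
  · rintro ⟨a, ha, haF⟩
    exact ⟨a⁻¹, inv_mem_inv.2 ha, haF⟩

theorem dom_extend (F : Set S) : dom (extend F) = extend (dom F) := by
  rw [dom, extend_inv, extend_up_mul, dom]

theorem ran_extend (F : Set S) : ran (extend F) = extend (ran F) := by
  rw [ran, extend_inv, extend_up_mul, ran]

theorem dom_extend_eq_ran_extend {F G : Set S} :
    dom (extend F) = ran (extend G) ↔ dom F = ran G := by
  rw [dom_extend, ran_extend]
  exact extend_inj (mem_up_of_natLE _) (mem_up_of_natLE _)

theorem extend_mem_identities {F : Set S} (hF : IsProperFilter F) :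
    extend F ∈ identities (DistCompletion S) ↔ ∃ e ∈ F, IsIdempotentElem e := by
  constructor
  · rintro ⟨-, E, ⟨e, heE, heF⟩, hE⟩
    exact ⟨e, heF, E.idem_subset hE.eq heE⟩
  · rintro ⟨e, heF, he⟩
    refine ⟨hF.isPrimeFilter, principal e, (principal_mem_extend hF.mem_of_natLE).2 heF, ?_⟩
    change principal e * principal e = principal e
    rw [principal_mul, he.eq]

theorem IsProperFilter.inv {F : Set S} (hF : IsProperFilter F) : IsProperFilter F⁻¹ := by
  refine ⟨?_, fun a ha b hab => hF.mem_of_natLE _ ha _ (natLE_inv hab), fun a ha b hb => ?_,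
    fun h => hF.zero_notMem ?_⟩
  · obtain ⟨a, ha⟩ := hF.nonempty
    exact ⟨a⁻¹, inv_mem_inv.2 ha⟩
  · obtain ⟨c, hc, hca, hcb⟩ := hF.directed _ ha _ hb
    refine ⟨c⁻¹, inv_mem_inv.2 hc, ?_, ?_⟩
    · simpa only [inv_inv_eq] using natLE_inv hca
    · simpa only [inv_inv_eq] using natLE_inv hcb
  · rwa [mem_inv_set, inv_zero_eq] at h

theorem isProperFilter_up_singleton {r : S} (hr : r ≠ 0) : IsProperFilter (up {r}) := by
  refine ⟨⟨r, r, rfl, natLE_refl r⟩, mem_up_of_natLE _, ?_, ?_⟩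
  · rintro a ⟨_, rfl, ha⟩ b ⟨_, rfl, hb⟩
    exact ⟨_, ⟨_, rfl, natLE_refl _⟩, ha, hb⟩
  · rintro ⟨_, rfl, h⟩
    exact hr (eq_zero_of_natLE h)

/-- A common lower bound `c` of `a` and `b` in `F` satisfies `c⁻¹ * c ≤ a⁻¹ * b`. -/
theorem IsProperFilter.mem_dom {F : Set S} (hF : IsProperFilter F) {u : S} :
    u ∈ dom F ↔ ∃ f ∈ F, NatLE (f⁻¹ * f) u := by
  constructor
  · rintro ⟨_, ⟨a, ha, b, hb, rfl⟩, h⟩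
    obtain ⟨c, hc, hca, hcb⟩ := hF.directed _ ha _ hb
    refine ⟨c, hc, natLE_trans (natLE_mul ?_ hcb) h⟩
    simpa only [inv_inv_eq] using natLE_inv hca
  · rintro ⟨f, hf, h⟩
    exact ⟨f⁻¹ * f, ⟨f⁻¹, inv_mem_inv.2 hf, f, hf, rfl⟩, h⟩

theorem IsProperFilter.mem_ran {F : Set S} (hF : IsProperFilter F) {u : S} :
    u ∈ ran F ↔ ∃ f ∈ F, NatLE (f * f⁻¹) u := by
  have := hF.inv.mem_dom (u := u)
  rw [dom, inv_inv_set] at this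
  rw [ran, this]
  constructor
  · rintro ⟨f, hf, h⟩
    exact ⟨f⁻¹, hf, by rwa [inv_inv_eq]⟩
  · rintro ⟨f, hf, h⟩
    exact ⟨f⁻¹, inv_mem_inv.2 hf, by rwa [inv_inv_eq]⟩

end Filters

/-! ### Filters that are eventually in a constructible set -/

section Eventually

variable {S : Type u} [InverseSemigroupWithZero S]

open InverseSemigroupWithZero

/-- `X` contains all sufficiently small elements of `F`. -/
def EventuallyIn (F X : Set S) : Prop := ∃ s ∈ F, ∀ r ∈ F, NatLE r s → r ∈ X

theorem EventuallyIn.mono {F X Y : Set S} (h : EventuallyIn F X) (hXY : X ⊆ Y) :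
    EventuallyIn F Y := by
  obtain ⟨s, hs, h⟩ := h
  exact ⟨s, hs, fun r hr hrs => hXY (h r hr hrs)⟩

theorem EventuallyIn.inter {F X Y : Set S} (hF : IsProperFilter F) (h : EventuallyIn F X)
    (h' : EventuallyIn F Y) : EventuallyIn F (X ∩ Y) := by
  obtain ⟨s, hs, h⟩ := h
  obtain ⟨t, ht, h'⟩ := h'
  obtain ⟨c, hc, hcs, hct⟩ := hF.directed s hs t ht
  exact ⟨c, hc, fun r hr hrc =>
    ⟨h r hr (natLE_trans hrc hcs), h' r hr (natLE_trans hrc hct)⟩⟩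

theorem not_eventuallyIn_empty (F : Set S) : ¬EventuallyIn F ∅ :=
  fun ⟨s, hs, h⟩ => h s hs (natLE_refl s)

/-- Some member of `F` below `s` is absorbed by `e` exactly if `s * e ∈ F`. -/
theorem eventuallyIn_cone {F : Set S} (hF : IsProperFilter F) {s : S} {L : Set S}
    (hi : ∀ e ∈ L, IsIdempotentElem e) :
    EventuallyIn F (cone s L) ↔ s ∈ F ∧ ∀ e ∈ L, s * e ∉ F := by
  constructor
  · rintro ⟨t, ht, h⟩
    refine ⟨hF.mem_of_natLE t ht s (h t ht (natLE_refl t)).2.1, fun e he hse => ?_⟩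
    obtain ⟨c, hc, hct, hcs⟩ := hF.directed t ht _ hse
    exact (h c hc hct).2.2 e he
      (mul_eq_self_of_natLE hcs (hi e he) (mul_idem_mul_idem (hi e he) s))
  · rintro ⟨hs, h⟩
    refine ⟨s, hs, fun r hr hrs => ⟨fun h0 => hF.zero_notMem (h0 ▸ hr), hrs, fun e he hre => ?_⟩⟩
    exact h e he (hF.mem_of_natLE r hr _ (natLE_mul_of_mul_eq hrs hre))

/-- For a cone, the filter is eventually outside if it misses `s` or contains some `s * e`, and
eventually inside otherwise. Finite unions inherit the alternative by directedness. -/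
theorem Constructible.eventuallyIn_or {F X : Set S} (hF : IsProperFilter F)
    (hX : Constructible X) : EventuallyIn F X ∨ EventuallyIn F Xᶜ := by
  induction hX using Constructible.induction with
  | empty =>
    obtain ⟨s, hs⟩ := hF.nonempty
    exact Or.inr ⟨s, hs, by simp⟩
  | cone_union s L Y hL hi hY ih _ =>
    have hc : EventuallyIn F (cone s L) ∨ EventuallyIn F (cone s L)ᶜ := by
      rw [or_iff_not_imp_left, eventuallyIn_cone hF hi]
      intro h
      by_cases hs : s ∈ F
      · push Not at h
        obtain ⟨e, he, hse⟩ := h hs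
        exact ⟨s * e, hse, fun r hr hrs hrc => hrc.2.2 e he
          (mul_eq_self_of_natLE hrs (hi e he) (mul_idem_mul_idem (hi e he) s))⟩
      · obtain ⟨t, ht⟩ := hF.nonempty
        exact ⟨t, ht, fun r hr _ hrc => hs (hF.mem_of_natLE r hr s hrc.2.1)⟩
    rcases hc with hc | hc
    · exact Or.inl (hc.mono Set.subset_union_left)
    · rcases ih with ih | ih
      · exact Or.inl (ih.mono Set.subset_union_right)
      · rw [Set.compl_union]
        exact Or.inr (hc.inter hF ih)

theorem eventuallyIn_union {F X Y : Set S} (hF : IsProperFilter F) (hX : Constructible X) :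
    EventuallyIn F (X ∪ Y) ↔ EventuallyIn F X ∨ EventuallyIn F Y := by
  constructor
  · intro h
    rcases hX.eventuallyIn_or hF with hX | hX
    · exact Or.inl hX
    · refine Or.inr ((h.inter hF hX).mono ?_)
      rintro r ⟨hr | hr, hr'⟩
      exacts [absurd hr hr', hr]
  · rintro (h | h)
    exacts [h.mono Set.subset_union_left, h.mono Set.subset_union_right]

theorem eventuallyIn_biUnion {ι : Type v} {F : Set S} (hF : IsProperFilter F) {I : Set ι}
    (hI : I.Finite) {f : ι → Set S} (hf : ∀ i ∈ I, Constructible (f i)) :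
    EventuallyIn F (⋃ i ∈ I, f i) ↔ ∃ i ∈ I, EventuallyIn F (f i) := by
  induction I, hI using Set.Finite.induction_on with
  | empty => simpa using not_eventuallyIn_empty F
  | insert _ _ ih =>
    rw [Set.biUnion_insert, eventuallyIn_union hF (hf _ (Set.mem_insert _ _)),
      ih fun i hi => hf i (Set.mem_insert_of_mem _ hi), Set.exists_mem_insert]

/-- The filter has the least element `r`, so `X` can be read off from principal filters. -/
theorem eventuallyIn_up_singleton {r : S} {X : Set S} : EventuallyIn (up {r}) X ↔ r ∈ X := by
  constructor
  · rintro ⟨s, ⟨_, rfl, hs⟩, h⟩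
    exact h _ ⟨_, rfl, natLE_refl _⟩ hs
  · refine fun h => ⟨r, ⟨r, rfl, natLE_refl r⟩, ?_⟩
    rintro t ⟨_, rfl, ht⟩ ht'
    rwa [natLE_antisymm ht' ht]

theorem EventuallyIn.inv {F X : Set S} (h : EventuallyIn F X) : EventuallyIn F⁻¹ X⁻¹ := by
  obtain ⟨s, hs, h⟩ := h
  refine ⟨s⁻¹, inv_mem_inv.2 hs, fun r hr hrs => h _ hr ?_⟩
  simpa only [inv_inv_eq] using natLE_inv hrs

/-- For composable filters `F`, `G` and given elements, there are smaller elements of `F`, `G`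
such that the range of the latter is below the domain of the former. -/
theorem exists_ran_natLE_dom {F G : Set S} (hF : IsProperFilter F) (hG : IsProperFilter G)
    (h : dom F = ran G) {f g : S} (hf : f ∈ F) (hg : g ∈ G) :
    ∃ g' ∈ G, NatLE g' g ∧ NatLE (g' * g'⁻¹) (f⁻¹ * f) := by
  have h1 : f⁻¹ * f ∈ ran G := h ▸ hF.mem_dom.2 ⟨f, hf, natLE_refl _⟩
  obtain ⟨g1, hg1, hle⟩ := hG.mem_ran.1 h1
  obtain ⟨c, hc, hcg, hcg1⟩ := hG.directed g hg g1 hg1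
  exact ⟨c, hc, hcg, natLE_trans (natLE_mul hcg1 (natLE_inv hcg1)) hle⟩

theorem exists_dom_natLE_ran {F G : Set S} (hF : IsProperFilter F) (hG : IsProperFilter G)
    (h : dom F = ran G) {f g : S} (hf : f ∈ F) (hg : g ∈ G) :
    ∃ f' ∈ F, NatLE f' f ∧ NatLE (f'⁻¹ * f') (g * g⁻¹) := by
  have h1 : g * g⁻¹ ∈ dom F := h ▸ hG.mem_ran.2 ⟨g, hg, natLE_refl _⟩
  obtain ⟨f1, hf1, hle⟩ := hF.mem_dom.1 h1
  obtain ⟨c, hc, hcf, hcf1⟩ := hF.directed f hf f1 hf1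
  exact ⟨c, hc, hcf, natLE_trans (natLE_mul (natLE_inv hcf1) hcf1) hle⟩

theorem idem_mul_of_natLE {e f : S} (hf : IsIdempotentElem f) (h : NatLE e f) : f * e = e := by
  obtain ⟨g, hg, rfl⟩ := h
  rw [← mul_assoc, hf.eq]

theorem mul_eq_self_of_dom_natLE {f e : S} (he : IsIdempotentElem e)
    (h : NatLE (f⁻¹ * f) e) : f * e = f := by
  calc f * e = f * (f⁻¹ * f * e) := by rw [← mul_assoc, ← mul_assoc, mul_inv_mul]
    _ = f := by rw [idem_comm (idem_inv_mul f) he, idem_mul_of_natLE he h, ← mul_assoc,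
      mul_inv_mul]

theorem mul_eq_self_of_ran_natLE {f e : S} (he : IsIdempotentElem e)
    (h : NatLE (f * f⁻¹) e) : e * f = f := by
  calc e * f = e * (f * f⁻¹) * f := by rw [mul_assoc, mul_inv_mul]
    _ = f := by rw [idem_mul_of_natLE he h, mul_inv_mul]

theorem IsProperFilter.mul {F G : Set S} (hF : IsProperFilter F) (hG : IsProperFilter G)
    (h : dom F = ran G) : IsProperFilter (up (F * G)) := by
  refine ⟨?_, mem_up_of_natLE _, ?_, ?_⟩
  · obtain ⟨f, hf⟩ := hF.nonempty
    obtain ⟨g, hg⟩ := hG.nonempty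
    exact ⟨f * g, f * g, ⟨f, hf, g, hg, rfl⟩, natLE_refl _⟩
  · rintro a ⟨_, ⟨f, hf, g, hg, rfl⟩, ha⟩ b ⟨_, ⟨f', hf', g', hg', rfl⟩, hb⟩
    obtain ⟨c, hc, hcf, hcf'⟩ := hF.directed f hf f' hf'
    obtain ⟨d, hd, hdg, hdg'⟩ := hG.directed g hg g' hg'
    exact ⟨c * d, ⟨c * d, ⟨c, hc, d, hd, rfl⟩, natLE_refl _⟩, natLE_trans (natLE_mul hcf hdg) ha,
      natLE_trans (natLE_mul hcf' hdg') hb⟩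
  · rintro ⟨_, ⟨f, hf, g, hg, rfl⟩, h0⟩
    -- If `f * g = 0`, then a smaller `g'` with range below the domain of `f` satisfies `g' = f⁻¹ *
    -- f * g' = 0`.
    obtain ⟨g', hg', hgg, hle⟩ := exists_ran_natLE_dom hF hG h hf hg
    have h1 : f * g' = 0 := eq_zero_of_natLE (natLE_trans (natLE_mul (natLE_refl f) hgg) h0)
    have h2 := mul_eq_self_of_ran_natLE (idem_inv_mul f) hle
    rw [mul_assoc, h1, mul_zero] at h2
    exact hG.zero_notMem (h2 ▸ hg')

/-- Factor a small `p` above `f * g` as in `mul_inv_mul_mul_cancel`. For `f' ≤ f` with domain below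
`g * g⁻¹`, one has `f' = f' * g * g⁻¹ ≤ p * t⁻¹`, so the left factor is in `F`; shrinking `g`
instead puts the right factor into `G`. -/
theorem EventuallyIn.mul {F G X Y : Set S} (hF : IsProperFilter F) (hG : IsProperFilter G)
    (h : dom F = ran G) (hX : EventuallyIn F X) (hY : EventuallyIn G Y) :
    EventuallyIn (up (F * G)) (resMul X Y) := by
  obtain ⟨s, hs, hX⟩ := hX
  obtain ⟨t, ht, hY⟩ := hY
  refine ⟨s * t, ⟨s * t, ⟨s, hs, t, ht, rfl⟩, natLE_refl _⟩, ?_⟩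
  rintro p ⟨_, ⟨f, hf, g, hg, rfl⟩, hp⟩ hpst
  change NatLE (f * g) p at hp
  obtain ⟨f, hf, hff, hfs⟩ := hF.directed f hf s hs
  obtain ⟨g, hg, hgg, hgt⟩ := hG.directed g hg t ht
  have hp := natLE_trans (natLE_mul hff hgg) hp
  refine ⟨p * t⁻¹, hX _ ?_ (mul_inv_natLE hpst), t * (p⁻¹ * p), hY _ ?_
    (natLE_mul_idem (idem_inv_mul p) t), conj_inv_mul t p,
    (mul_inv_mul_mul_cancel t p hpst).symm⟩
  · obtain ⟨f', hf', hff', hle⟩ := exists_dom_natLE_ran hF hG h hf hg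
    refine hF.mem_of_natLE f' hf' _ ?_
    rw [← mul_eq_self_of_dom_natLE (idem_mul_inv g) hle, ← mul_assoc]
    exact natLE_mul (natLE_trans (natLE_mul hff' (natLE_refl g)) hp) (natLE_inv hgt)
  · obtain ⟨g', hg', hgg', hle⟩ := exists_ran_natLE_dom hF hG h hf hg
    refine hG.mem_of_natLE g' hg' _ ?_
    have h1 : g' = g' * ((f * g')⁻¹ * (f * g')) := by
      calc g' = g' * (g'⁻¹ * (f⁻¹ * f * g')) := by
            rw [mul_eq_self_of_ran_natLE (idem_inv_mul f) hle, ← mul_assoc, mul_inv_mul]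
        _ = g' * ((f * g')⁻¹ * (f * g')) := by rw [mul_inv_eq]; simp only [mul_assoc]
    rw [h1]
    have h2 := natLE_trans (natLE_mul (natLE_refl f) hgg') hp
    exact natLE_mul (natLE_trans hgg' hgt) (natLE_mul (natLE_inv h2) h2)

/-- A filter that contains a product factors accordingly. -/
theorem exists_factor {R : Set S} (hR : IsProperFilter R) {s t : S} {L M : Set S}
    (hL : ∀ e ∈ L, IsIdempotentElem e) (hM : ∀ e ∈ M, IsIdempotentElem e)
    (h : EventuallyIn R (resMul (cone s L) (cone t M))) :
    ∃ F G, IsProperFilter F ∧ IsProperFilter G ∧ dom F = ran G ∧ R = up (F * G) ∧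
      EventuallyIn F (cone s L) ∧ EventuallyIn G (cone t M) := by
  rw [resMul_cone s t L M hL, eventuallyIn_cone hR] at h
  swap
  · rintro _ (⟨e, he, rfl⟩ | he)
    exacts [idem_conj' t (hL e he), hM _ he]
  obtain ⟨hst, hLM⟩ := h
  have small : ∀ p ∈ R, ∃ q ∈ R, NatLE q p ∧ NatLE q (s * t) := fun p hp =>
    hR.directed p hp _ hst
  -- The filters sought are generated by the left and the right factors of the members of `R`.
  have hF : IsProperFilter {r | ∃ p ∈ R, NatLE (p * t⁻¹) r} := by
    refine ⟨⟨s * t * t⁻¹, s * t, hst, natLE_refl _⟩, ?_, ?_, ?_⟩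
    · rintro a ⟨p, hp, ha⟩ b hab
      exact ⟨p, hp, natLE_trans ha hab⟩
    · rintro a ⟨p, hp, ha⟩ b ⟨q, hq, hb⟩
      obtain ⟨c, hc, hcp, hcq⟩ := hR.directed p hp q hq
      exact ⟨c * t⁻¹, ⟨c, hc, natLE_refl _⟩, natLE_trans (natLE_mul hcp (natLE_refl _)) ha,
        natLE_trans (natLE_mul hcq (natLE_refl _)) hb⟩
    · rintro ⟨p, hp, h0⟩
      obtain ⟨q, hq, hqp, hqs⟩ := small p hp
      have h1 := eq_zero_of_natLE (natLE_trans (natLE_mul hqp (natLE_refl t⁻¹)) h0)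
      have h2 := mul_mul_inv_mul_cancel t q hqs
      rw [h1, zero_mul] at h2
      exact hR.zero_notMem (h2 ▸ hq)
  have hG : IsProperFilter {q | ∃ p ∈ R, NatLE (t * (p⁻¹ * p)) q} := by
    refine ⟨⟨_, s * t, hst, natLE_refl _⟩, ?_, ?_, ?_⟩
    · rintro a ⟨p, hp, ha⟩ b hab
      exact ⟨p, hp, natLE_trans ha hab⟩
    · rintro a ⟨p, hp, ha⟩ b ⟨q, hq, hb⟩
      obtain ⟨c, hc, hcp, hcq⟩ := hR.directed p hp q hq
      exact ⟨t * (c⁻¹ * c), ⟨c, hc, natLE_refl _⟩,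
        natLE_trans (natLE_mul (natLE_refl _) (natLE_mul (natLE_inv hcp) hcp)) ha,
        natLE_trans (natLE_mul (natLE_refl _) (natLE_mul (natLE_inv hcq) hcq)) hb⟩
    · rintro ⟨p, hp, h0⟩
      obtain ⟨q, hq, hqp, hqs⟩ := small p hp
      have h1 := eq_zero_of_natLE
        (natLE_trans (natLE_mul (natLE_refl t) (natLE_mul (natLE_inv hqp) hqp)) h0)
      have h2 := mul_inv_mul_mul_cancel t q hqs
      rw [h1, mul_zero] at h2
      exact hR.zero_notMem (h2 ▸ hq)
  refine ⟨_, _, hF, hG, ?_, ?_, ?_, ?_⟩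
  · ext u
    rw [hF.mem_dom, hG.mem_ran]
    constructor
    · rintro ⟨r, ⟨p, hp, hr⟩, hu⟩
      refine ⟨t * (p⁻¹ * p), ⟨p, hp, natLE_refl _⟩, natLE_trans ?_ hu⟩
      rw [← conj_inv_mul]
      exact natLE_mul (natLE_inv hr) hr
    · rintro ⟨q, ⟨p, hp, hq⟩, hu⟩
      refine ⟨p * t⁻¹, ⟨p, hp, natLE_refl _⟩, natLE_trans ?_ hu⟩
      rw [conj_inv_mul]
      exact natLE_mul hq (natLE_inv hq)
  · ext a
    constructor
    · intro ha
      obtain ⟨q, hq, hqa, hqs⟩ := small a ha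
      exact ⟨q * t⁻¹ * (t * (q⁻¹ * q)), ⟨_, ⟨q, hq, natLE_refl _⟩, _, ⟨q, hq, natLE_refl _⟩, rfl⟩,
        by rwa [mul_inv_mul_mul_cancel t q hqs]⟩
    · rintro ⟨_, ⟨f, ⟨p, hp, hpf⟩, g, ⟨q, hq, hqg⟩, rfl⟩, ha⟩
      obtain ⟨c, hc, hcp, hcq⟩ := hR.directed p hp q hq
      obtain ⟨d, hd, hdc, hds⟩ := small c hc
      refine hR.mem_of_natLE d hd a (natLE_trans ?_ ha)
      rw [← mul_inv_mul_mul_cancel t d hds]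
      have hdq := natLE_trans hdc hcq
      exact natLE_mul
        (natLE_trans (natLE_mul (natLE_trans hdc hcp) (natLE_refl t⁻¹)) hpf)
        (natLE_trans (natLE_mul (natLE_refl t) (natLE_mul (natLE_inv hdq) hdq)) hqg)
  · rw [eventuallyIn_cone hF hL]
    refine ⟨⟨s * t, hst, mul_inv_natLE (natLE_refl _)⟩, ?_⟩
    -- If `s * e` were in the left filter, then `s * e * t`, which equals `s * t * (t⁻¹ * e * t)`,
    -- would be in `R`, against the conjugated condition.
    rintro e he ⟨p, hp, hpe⟩
    obtain ⟨q, hq, hqp, hqs⟩ := small p hp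
    refine hLM _ (Or.inl ⟨e, he, rfl⟩) (hR.mem_of_natLE q hq _ ?_)
    have h1 : s * t * (t⁻¹ * e * t) = s * e * t := by
      calc s * t * (t⁻¹ * e * t) = s * ((t * t⁻¹) * e) * t := by simp only [mul_assoc]
        _ = s * e * (t * t⁻¹ * t) := by
          rw [idem_comm (idem_mul_inv t) (hL e he)]; simp only [mul_assoc]
        _ = s * e * t := by rw [mul_inv_mul]
    rw [h1, ← mul_mul_inv_mul_cancel t q hqs]
    exact natLE_mul (natLE_trans (natLE_mul hqp (natLE_refl _)) hpe) (natLE_refl t)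
  · rw [eventuallyIn_cone hG hM]
    refine ⟨⟨s * t, hst, natLE_mul_idem (idem_inv_mul _) t⟩, ?_⟩
    rintro e he ⟨p, hp, hpe⟩
    obtain ⟨q, hq, hqp, hqs⟩ := small p hp
    refine hLM _ (Or.inr he) (hR.mem_of_natLE q hq _ ?_)
    rw [← mul_inv_mul_of_natLE hqs, mul_assoc, mul_assoc]
    exact natLE_mul (natLE_refl s)
      (natLE_trans (natLE_mul (natLE_refl t) (natLE_mul (natLE_inv hqp) hqp)) hpe)

end Eventually

/-! ### The representation by sets of prime filters -/

section Spectrum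

variable {S : Type u} [InverseSemigroupWithZero S]

open InverseSemigroupWithZero

/-- The set of prime filters of the distributive completion in the closure of `X`. -/
def spec (X : Set S) : Set (Set (DistCompletion S)) :=
  {P | ∃ F, IsProperFilter F ∧ EventuallyIn F X ∧ P = extend F}

theorem extend_mem_spec {F X : Set S} (hF : IsProperFilter F) :
    extend F ∈ spec X ↔ EventuallyIn F X := by
  refine ⟨fun ⟨G, hG, h, he⟩ => ?_, fun h => ⟨F, hF, h, rfl⟩⟩
  rwa [(extend_inj hF.mem_of_natLE hG.mem_of_natLE).1 he]

/-- It suffices to test the inclusion on the principal filters `up {r}` with `r ∈ X`. -/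
theorem spec_subset_iff {X Y : Set S} (h0 : (0 : S) ∉ X) : spec X ⊆ spec Y ↔ X ⊆ Y := by
  constructor
  · intro h r hr
    have hr0 : r ≠ 0 := fun h => h0 (h ▸ hr)
    have hF := isProperFilter_up_singleton hr0
    rw [← eventuallyIn_up_singleton, ← extend_mem_spec hF]
    exact h ((extend_mem_spec hF).2 (eventuallyIn_up_singleton.2 hr))
  · rintro h _ ⟨F, hF, hX, rfl⟩
    exact ⟨F, hF, hX.mono h, rfl⟩

theorem spec_inv (X : Set S) : spec X⁻¹ = bisInv (spec X) := by
  ext P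
  constructor
  · rintro ⟨F, hF, hX, rfl⟩
    refine ⟨extend F⁻¹, ⟨F⁻¹, hF.inv, ?_, rfl⟩, ?_⟩
    · simpa only [inv_inv_set] using hX.inv
    · change (extend F⁻¹)⁻¹ = extend F
      rw [extend_inv, inv_inv_set]
  · rintro ⟨_, ⟨F, hF, hX, rfl⟩, rfl⟩
    exact ⟨F⁻¹, hF.inv, hX.inv, extend_inv F⟩

/-- A filter that is eventually in a product of finite unions is eventually in a product of two
single cones, where `exists_factor` applies. The other inclusion is `EventuallyIn.mul`. -/
theorem spec_resMul {X Y : Set S} (hX : Constructible X) (hY : Constructible Y) :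
    spec (resMul X Y) = bisMul (spec X) (spec Y) := by
  ext P
  constructor
  · rintro ⟨R, hR, h, rfl⟩
    obtain ⟨A, hA, hAc, rfl⟩ := hX
    obtain ⟨B, hB, hBc, rfl⟩ := hY
    rw [resMul_sUnion, Set.sUnion_eq_biUnion, eventuallyIn_biUnion hR (hA.image2 _ hB)] at h
    · obtain ⟨_, ⟨X, hX, Y, hY, rfl⟩, h⟩ := h
      obtain ⟨s, L, -, hL, rfl⟩ := hAc X hX
      obtain ⟨t, M, -, hM, rfl⟩ := hBc Y hY
      obtain ⟨F, G, hF, hG, hFG, rfl, hFX, hGY⟩ := exists_factor hR hL hM h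
      exact ⟨extend F, ⟨F, hF, hFX.mono (Set.subset_sUnion_of_mem hX), rfl⟩, extend G,
        ⟨G, hG, hGY.mono (Set.subset_sUnion_of_mem hY), rfl⟩, dom_extend_eq_ran_extend.2 hFG,
        (extend_up_mul F G).symm⟩
    · rintro _ ⟨X, hX, Y, hY, rfl⟩
      exact ((hAc X hX).resMul (hBc Y hY)).constructible
  · rintro ⟨_, ⟨F, hF, hFX, rfl⟩, _, ⟨G, hG, hGY, rfl⟩, hFG, rfl⟩
    rw [dom_extend_eq_ran_extend] at hFG
    exact ⟨up (F * G), hF.mul hG hFG, hFX.mul hF hG hFG hGY, extend_up_mul F G⟩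

/-- If `up {r}` contains an idempotent, then `r` lies below it and is idempotent. Compatibility of
sets of prime filters can therefore be tested on elements of `S`. -/
theorem spec_subset_identities {X : Set S} (h0 : (0 : S) ∉ X) :
    spec X ⊆ identities (DistCompletion S) ↔ ∀ x ∈ X, IsIdempotentElem x := by
  constructor
  · intro h r hr
    have hr0 : r ≠ 0 := fun h => h0 (h ▸ hr)
    have hF := isProperFilter_up_singleton hr0
    obtain ⟨e, ⟨_, rfl, he⟩, hi⟩ := (extend_mem_identities hF).1
      (h ((extend_mem_spec hF).2 (eventuallyIn_up_singleton.2 hr)))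
    exact idem_of_natLE he hi
  · rintro h _ ⟨F, hF, ⟨s, hs, hX⟩, rfl⟩
    exact (extend_mem_identities hF).2 ⟨s, hs, h s (hX s hs (natLE_refl s))⟩

theorem idem_of_bisCompatible {X Y : Set S} (hX : Constructible X)
    (hY : Constructible Y) (h : BisCompatible (spec X) (spec Y)) :
    (∀ p ∈ resMul X⁻¹ Y, IsIdempotentElem p) ∧ ∀ p ∈ resMul X Y⁻¹, IsIdempotentElem p := by
  rw [BisCompatible, ← spec_inv, ← spec_inv, ← spec_resMul hX.inv hY, ← spec_resMul hX hY.inv,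
    spec_subset_identities (hX.inv.resMul hY).zero_notMem,
    spec_subset_identities (hX.resMul hY.inv).zero_notMem] at h
  exact h

theorem IsBisection.bisCompatible {X Y Z : Set S} (hX : IsBisection X) (hY : Constructible Y)
    (hZ : Constructible Z) (hYX : Y ⊆ X) (hZX : Z ⊆ X) : BisCompatible (spec Y) (spec Z) := by
  rw [BisCompatible, ← spec_inv, ← spec_inv, ← spec_resMul hY.inv hZ, ← spec_resMul hY hZ.inv,
    spec_subset_identities (hY.inv.resMul hZ).zero_notMem,
    spec_subset_identities (hY.resMul hZ.inv).zero_notMem]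
  exact ⟨fun p hp => hX.idem_inv_resMul (resMul_mono (inv_subset_inv hYX) hZX hp),
    fun p hp => hX.idem_resMul_inv (resMul_mono hYX (inv_subset_inv hZX) hp)⟩

theorem spec_sUnion {A : Set (Set S)} (hA : A.Finite) (hc : ∀ Y ∈ A, Constructible Y) :
    spec (⋃₀ A) = ⋃₀ (spec '' A) := by
  ext P
  constructor
  · rintro ⟨F, hF, h, rfl⟩
    rw [Set.sUnion_eq_biUnion, eventuallyIn_biUnion hF hA hc] at h
    obtain ⟨Y, hY, h⟩ := h
    exact ⟨spec Y, ⟨Y, hY, rfl⟩, F, hF, h, rfl⟩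
  · rintro ⟨_, ⟨Y, hY, rfl⟩, F, hF, h, rfl⟩
    exact ⟨F, hF, h.mono (Set.subset_sUnion_of_mem hY), rfl⟩

theorem extend_mem_V {F : Set S} (hF : IsProperFilter F) {A : DistCompletion S} :
    extend F ∈ V A ↔ ∃ a ∈ A.1, a ∈ F :=
  ⟨fun h => h.2, fun h => ⟨hF.isPrimeFilter, h⟩⟩

theorem spec_eq_of_forall {X : Set S} {Q : Set (Set (DistCompletion S))}
    (hQ : ∀ P ∈ Q, IsPrimeFilter P)
    (h : ∀ F, IsProperFilter F → (EventuallyIn F X ↔ extend F ∈ Q)) : spec X = Q := by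
  ext P
  constructor
  · rintro ⟨F, hF, hX, rfl⟩
    exact (h F hF).1 hX
  · intro hP
    obtain ⟨F, hF, rfl⟩ := isPrimeFilter_iff.1 (hQ P hP)
    exact ⟨F, hF, (h F hF).2 hP, rfl⟩

theorem spec_of (s : S) : spec (cone s ∅) = V (principal s) := by
  refine spec_eq_of_forall (fun P hP => hP.1) fun F hF => ?_
  rw [eventuallyIn_cone hF (by simp), extend_mem_V hF]
  exact ⟨fun h => ⟨s, mem_principal.2 (natLE_refl s), h.1⟩,
    fun ⟨a, ha, haF⟩ => ⟨hF.mem_of_natLE a haF s (mem_principal.1 ha), by simp⟩⟩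

theorem IsCone.spec_eq {Y : Set S} (hY : IsCone Y) :
    ∃ A B : DistCompletion S, NatLE B A ∧ spec Y = V A \ V B := by
  obtain ⟨s, L, hL, hi, rfl⟩ := hY
  -- The ideal to be removed is generated by the `s * e`; `0` is added because `L` may be empty
  -- while a generating set may not.
  have hle : ∀ a ∈ insert 0 ((fun e => s * e) '' L), NatLE a s := by
    rintro a (rfl | ⟨e, he, rfl⟩)
    exacts [zero_natLE s, natLE_mul_idem (hi e he) s]
  refine ⟨principal s, DistCompletion.gen (insert 0 ((fun e => s * e) '' L))
    ((hL.image _).insert 0) (Set.insert_nonempty _ _)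
    fun a ha b hb => compatible_of_common_bound (hle a ha) (hle b hb), ?_, ?_⟩
  · rw [DistCompletion.natLE_iff]
    exact down_subset_iff.2 fun a ha => mem_principal.2 (hle a ha)
  · refine spec_eq_of_forall (fun P hP => hP.1.1) fun F hF => ?_
    rw [eventuallyIn_cone hF hi, Set.mem_sdiff, extend_mem_V hF, extend_mem_V hF]
    refine and_congr ?_ ?_
    · exact ⟨fun h => ⟨s, mem_principal.2 (natLE_refl s), h⟩,
        fun ⟨a, ha, haF⟩ => hF.mem_of_natLE a haF s (mem_principal.1 ha)⟩
    · constructor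
      · rintro h ⟨a, ⟨b, rfl | ⟨e, he, rfl⟩, hab⟩, haF⟩
        · exact hF.zero_notMem (hF.mem_of_natLE a haF _ hab)
        · exact h e he (hF.mem_of_natLE a haF _ hab)
      · exact fun h e he hse => h ⟨s * e, ⟨s * e, Or.inr ⟨e, he, rfl⟩, natLE_refl _⟩, hse⟩

/-- Use the generators of `A` as apexes and the domains of the generators `t` of `B` as conditions.
Since `s` and `t` are compatible, `s * (t⁻¹ * t) ≤ t`, so a filter that contains this restriction
contains `t`. -/
theorem exists_spec_eq_V_diff_V {A B : DistCompletion S} (hBA : NatLE B A) :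
    ∃ X : Set S, Constructible X ∧ IsBisection X ∧ spec X = V A \ V B := by
  obtain ⟨G, hG, -, -, hAG⟩ := A.2
  obtain ⟨H, hH, -, -, hBH⟩ := B.2
  have hGA : G ⊆ A.1 := down_subset_iff.1 hAG.ge
  have hHB : H ⊆ B.1 := down_subset_iff.1 hBH.ge
  have hBA := DistCompletion.natLE_iff.1 hBA
  have hfin : ((fun t : S => t⁻¹ * t) '' H).Finite := hH.image _
  have hi : ∀ e ∈ (fun t : S => t⁻¹ * t) '' H, IsIdempotentElem e := by
    rintro _ ⟨t, _, rfl⟩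
    exact idem_inv_mul t
  have hc : Constructible (⋃ s ∈ G, cone s ((fun t : S => t⁻¹ * t) '' H)) :=
    constructible_biUnion hG fun s _ => constructible_cone hfin hi
  refine ⟨_, hc, isBisection_of_compatible hc.zero_notMem fun a ha b hb => ?_, ?_⟩
  · obtain ⟨s, hs, ha⟩ := Set.mem_iUnion₂.1 ha
    obtain ⟨t, ht, hb⟩ := Set.mem_iUnion₂.1 hb
    exact A.compat (A.lower (hGA hs) ha.2.1) (A.lower (hGA ht) hb.2.1)
  · refine spec_eq_of_forall (fun P hP => hP.1.1) fun F hF => ?_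
    rw [eventuallyIn_biUnion hF hG fun s _ => constructible_cone hfin hi, Set.mem_sdiff,
      extend_mem_V hF, extend_mem_V hF]
    simp only [eventuallyIn_cone hF hi]
    constructor
    · rintro ⟨s, hs, hsF, h⟩
      refine ⟨⟨s, hGA hs, hsF⟩, ?_⟩
      rintro ⟨b, hb, hbF⟩
      rw [hBH] at hb
      obtain ⟨t, ht, hbt⟩ := hb
      obtain ⟨c, hc, hcs, hct⟩ := hF.directed s hsF t (hF.mem_of_natLE b hbF t hbt)
      exact h _ ⟨t, ht, rfl⟩
        (hF.mem_of_natLE c hc _ (natLE_mul_of_mul_eq hcs (mul_inv_mul_self_of_natLE hct)))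
    · rintro ⟨⟨a, ha, haF⟩, h⟩
      rw [hAG] at ha
      obtain ⟨s, hs, has⟩ := ha
      refine ⟨s, hs, hF.mem_of_natLE a haF s has, ?_⟩
      rintro _ ⟨t, ht, rfl⟩ hst
      exact h ⟨t, hHB ht, hF.mem_of_natLE _ hst t
        (A.compat (hGA hs) (hBA (hHB ht))).natLE_left⟩

theorem range_spec :
    Set.range (fun X : Bis S => spec X.1) = finiteUnions (DistCompletion S) := by
  ext Q
  constructor
  · rintro ⟨⟨X, hX, hb⟩, rfl⟩
    obtain ⟨A, hA, hAc, rfl⟩ := hX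
    refine ⟨spec '' A, hA.image _, ?_, ?_, spec_sUnion hA fun Y hY => (hAc Y hY).constructible⟩
    · rintro _ ⟨Y, hY, rfl⟩
      exact (hAc Y hY).spec_eq
    · rintro _ ⟨Y, hY, rfl⟩ _ ⟨Z, hZ, rfl⟩
      exact hb.bisCompatible (hAc Y hY).constructible (hAc Z hZ).constructible
        (Set.subset_sUnion_of_mem hY) (Set.subset_sUnion_of_mem hZ)
  · rintro ⟨A, hA, hAV, hAc, rfl⟩
    have hex : ∀ Y ∈ A, ∃ X : Set S, Constructible X ∧ IsBisection X ∧ spec X = Y := by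
      intro Y hY
      obtain ⟨a, b, hba, rfl⟩ := hAV Y hY
      exact exists_spec_eq_V_diff_V hba
    choose! f hfc hfb hfs using hex
    have hc : Constructible (⋃ Y ∈ A, f Y) := constructible_biUnion hA hfc
    have hu : ∀ Y ∈ A, ∀ Z ∈ A, IsBisection (f Y ∪ f Z) := by
      intro Y hY Z hZ
      have := idem_of_bisCompatible (hfc Y hY) (hfc Z hZ)
        (by rw [hfs Y hY, hfs Z hZ]; exact hAc Y hY Z hZ)
      exact (hfb Y hY).union (hfb Z hZ) this.1 this.2
    -- Each injectivity condition involves two elements only, so it is enough that the unions of two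
    -- members are bisections.
    refine ⟨⟨⋃ Y ∈ A, f Y, hc, hc.zero_notMem, fun a ha b hb h => ?_, fun a ha b hb h => ?_⟩, ?_⟩
    · obtain ⟨Y, hY, ha⟩ := Set.mem_iUnion₂.1 ha
      obtain ⟨Z, hZ, hb⟩ := Set.mem_iUnion₂.1 hb
      exact (hu Y hY Z hZ).2 a (Or.inl ha) b (Or.inr hb) h
    · obtain ⟨Y, hY, ha⟩ := Set.mem_iUnion₂.1 ha
      obtain ⟨Z, hZ, hb⟩ := Set.mem_iUnion₂.1 hb
      exact (hu Y hY Z hZ).3 a (Or.inl ha) b (Or.inr hb) h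
    · change spec (⋃ Y ∈ A, f Y) = _
      rw [← Set.sUnion_image, spec_sUnion (hA.image f)]
      · rw [Set.image_image, Set.image_congr hfs, Set.image_id']
      · rintro _ ⟨Y, hY, rfl⟩
        exact hfc Y hY

theorem spec_injective : Function.Injective (fun X : Bis S => spec X.1) := by
  intro X Y h
  exact Subtype.ext (Set.Subset.antisymm ((spec_subset_iff X.2.2.1).1 h.le)
    ((spec_subset_iff Y.2.2.1).1 h.ge))

end Spectrum

/-! ### The left adjoint -/

section Adjoint

open CategoryTheory

/-- The embedding `Bis.beta` is the initial object: existence and uniqueness of arrows out of it are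
the universal property. -/
theorem hasInitial_structuredArrow_forgetful (X : InvCat.{u}) :
    Limits.HasInitial (StructuredArrow X forgetful.{u}) := by
  let B : BoolCat.{u} := ⟨Bis X.carrier⟩
  let i : StructuredArrow X forgetful.{u} :=
    StructuredArrow.mk (Y := B) (Bis.beta X.carrier : Hom X.carrier (Bis X.carrier))
  have hi : Limits.IsInitial i := by
    refine Limits.IsInitial.ofUniqueHom
      (fun A => StructuredArrow.homMk (Bis.lift (T := A.right.carrier) A.hom) ?_) ?_
    · exact Hom.ext (Bis.lift_beta (T := A.right.carrier) A.hom)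
    · intro A m
      apply StructuredArrow.ext
      exact (Bis.existsUnique_lift (T := A.right.carrier) A.hom).unique (y₁ := m.right)
        (y₂ := Bis.lift (T := A.right.carrier) A.hom) (StructuredArrow.w m)
        (Hom.ext (Bis.lift_beta (T := A.right.carrier) A.hom))
  exact hi.hasInitial

theorem forgetful_isRightAdjoint : (forgetful.{u}).IsRightAdjoint := by
  have := hasInitial_structuredArrow_forgetful.{u}
  exact isRightAdjointOfStructuredArrowInitials _

end Adjoint

end Booleanization

theorem theorem1p1 :
    (∀ (S : Type u) [InverseSemigroupWithZero S],
      ∃ (B : Type u) (_ : BooleanInverseSemigroup B) (β : Booleanization.Hom S B),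
        Function.Injective β ∧
        (∀ (T : Type v) [BooleanInverseSemigroup T] (θ : Booleanization.Hom S T),
          ∃! γ : Booleanization.Morphism B T, γ.toHom.comp β = θ) ∧
        ∃ ρ : B → Set (Set (DistCompletion S)),
          Function.Injective ρ ∧
          Set.range ρ = finiteUnions (DistCompletion S) ∧
          (∀ x y : B, ρ (x * y) = bisMul (ρ x) (ρ y)) ∧
          ∀ s : S, ρ (β s) = V (principal s)) ∧
    (forgetful.{u}).IsRightAdjoint := by
  refine ⟨fun S _ => ⟨Bis S, inferInstance, Bis.beta S, Bis.beta_injective,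
    fun T _ θ => Bis.existsUnique_lift θ, fun X => spec X.1, spec_injective, range_spec,
    fun X Y => spec_resMul X.2.1 Y.2.1, spec_of⟩, forgetful_isRightAdjoint⟩
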